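/- Let $n\ge 0$, let $\Gamma=\{1,\dots,m\}$ be a finite index set with the discrete topology, let $f_\gamma:\mathbb R^n\to\mathbb R^n$ ($\gamma\in\Gamma$) be continuous, write $f(\xi,\gamma)=f_\gamma(\xi)$, and let $|\cdot|$ be the Euclidean norm. A *switching signal* is a right-continuous piecewise constant map $\sigma:[0,\infty)\to\Gamma$ (with finitely many discontinuities in every bounded interval); its *switching times* are $t_0=0$ and its consecutive discontinuities $t_1<t_2<\cdots$. A *solution* of $\dot x=f(x,\sigma)$ on $I=[0,T)$ or $I=[0,T]$ is a continuous, piecewise $C^1$ curve $x:I\to\mathbb R^n$ with $\dot x(t)=f(x(t),\sigma(t))$ for every $t\in I$ that is not a switching time (a one-sided derivative at an end point $T \in I$). Let $\mathcal T$ be the set of all *maximal trajectories*, i.e. of all pairs $(x,\sigma)$ where $\sigma$ is a switching signal and $x$ is a maximal (non-extendable) solution with domain $\mathcal I_{(x,\sigma)}=[0,t_{(x,\sigma)})$, $0<t_{(x,\sigma)}\le\infty$. Let $\chi=\{\chi_\gamma\}_{\gamma\in\Gamma}$ be a covering of $\mathbb R^n$ by closed sets, $\Gamma^*=\{\gamma\in\Gamma: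 0\in\chi_\gamma\}$, and suppose $f(0,\gamma)=0$ for all $\gamma\in\Gamma^*$. Let $\mathcal T[\chi]$ be the set of all $(x,\sigma)\in\mathcal T$ with $x(t)\in\chi_{\sigma(t)}$ for all $t\in\mathcal I_{(x,\sigma)}$. For $\tau_D>0$ and an integer $N_0\ge 1$ let $\mathcal T_a[\tau_D,N_0]$ be the set of all $(x,\sigma)\in\mathcal T$ such that $\sigma$ has at most $N_0+(\tau_2-\tau_1)/\tau_D$ switching times in every open interval $(\tau_1,\tau_2)$ with $0\le\tau_1<\tau_2<\infty$, and let $\mathcal T_a=\bigcup_{\tau_D>0,N_0\ge 1}\mathcal T_a[\tau_D,N_0]$. Let $\mathcal T'\subseteq\mathcal T[\chi]\cap\mathcal T_a$ be any family of trajectories. A map $V:\mathbb R^n\times\Gamma\to\mathbb R$ is a *weak Lyapunov-like function* for $\mathcal T'$ if it is continuously differentiable in the first argument and 1. there are $\alpha_1,\alpha_2$ of class $\mathcal K_\infty$ (continuous, strictly increasing, unbounded maps $[0,\infty)\to[0,\infty)$ vanishing at $0$) with $\alpha_1(|\xi|)\le V(\xi,\gamma)\le\alpha_2(|\xi|)$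 whenever $\xi\in\chi_\gamma$; 2. $\frac{\partial V}{\partial\xi}(\xi,\gamma)f(\xi,\gamma)\le 0$ whenever $\xi\in\chi_\gamma$; 3. for every $(x,\sigma)\in\mathcal T'$ and all switching times $t_i<t_j$ in the domain of $x$ with $\sigma(t_i)=\sigma(t_j)$, $V(x(t_j),\sigma(t_j))\le V(x(t_{i+1}),\sigma(t_i))$. Let $\mathcal T_V^*$ be the set of all $(x,\sigma)\in\mathcal T$ such that $V(x(t),\sigma(t))=V(x(t'),\sigma(t'))$ for all $t,t'\in\mathcal I_{(x,\sigma)}$ with $\sigma(t)=\sigma(t')$. A nonempty set $M\subseteq\mathbb R^n\times\Gamma$ is *weakly invariant* with respect to a family $\mathcal T^*\subseteq\mathcal T$ if for each $(\xi,\gamma)\in M$ there is $(x,\sigma)\in\mathcal T^*$ with $x(0)=\xi$, $\sigma(0)=\gamma$ and $(x(t),\sigma(t))\in M$ for all $t\in\mathcal I_{(x,\sigma)}$. **Theorem.** Suppose that there is a weak Lyapunov-like function $V$ for $\mathcal T'$ such that $\{0\}\times\Gamma^*$ is the maximal (largest) weakly invariant set with respect to $\mathcal T_V^*\cap\mathcal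 T[\chi]\cap\mathcal T_a$. Then $\mathcal T'$ is *globally asymptotically stable*: all members of $\mathcal T'$ are defined on $[0,\infty)$; there is $\alpha$ of class $\mathcal K_\infty$ such that $|x(t)|\le\alpha(|x(t_0)|)$ for all $(x,\sigma)\in\mathcal T'$ and all $t\ge t_0\ge 0$; and $x(t)\to 0$ as $t\to\infty$ for every $(x,\sigma)\in\mathcal T'$. If in addition $\mathcal T'\subseteq\mathcal T_a[\tau_D,N_0]$ for some $\tau_D>0$ and some integer $N_0\ge 1$, then $\mathcal T'$ is *globally uniformly asymptotically stable*: there is a function $\beta:[0,\infty)^2\to[0,\infty)$, of class $\mathcal K_\infty$ in the first argument and decreasing (in the non-strict sense) to $0$ in the second one, such that $|x(t)|\le\beta(|x(t_0)|,t-t_0)$ for all $(x,\sigma)\in\mathcal T'$ and all $t\ge t_0\ge 0$. -/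

import Mathlib

open Set Filter Topology
open scoped NNReal

namespace Switched

/-! ### Comparison functions -/

/-- Class `K_∞`: strictly increasing, continuous, zero at zero, unbounded maps `ℝ₊ → ℝ₊`. -/
structure IsClassKInfty (α : ℝ≥0 → ℝ≥0) : Prop where
  strictMono : StrictMono α
  continuous : Continuous α
  map_zero : α 0 = 0
  unbounded : ¬ BddAbove (range α)

/-- Class `KL`: of class `K_∞` in the first argument, decreasing to zero in the second one. -/
structure IsClassKL (β : ℝ≥0 → ℝ≥0 → ℝ≥0) : Prop where
  classKInfty : ∀ s, IsClassKInfty (fun r => β r s)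
  antitone : ∀ r, Antitone (β r)
  tendsto_zero : ∀ r, Tendsto (β r) atTop (𝓝 0)

/-! ### Switching signals

A signal `ℝ₊ → {1, …, m}` is represented by a function on `ℝ`, whose values at negative
times play no role. The index set `Fin m` carries the discrete topology. -/

/-- The discontinuities of `σ` at positive times. -/
def discontinuities {m : ℕ} (σ : ℝ → Fin m) : Set ℝ :=
  {t | 0 < t ∧ ¬ ContinuousAt σ t}

/-- The switching times `t₀ = 0 < t₁ < t₂ < …`. -/
def switchingTimes {m : ℕ} (σ : ℝ → Fin m) : Set ℝ :=
  insert 0 (discontinuities σ)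

/-- `σ` is continuous from the right and piecewise constant on `ℝ₊`: it has finitely many
discontinuities in each bounded interval (between two of them it is continuous, hence constant). -/
structure IsSwitchingSignal {m : ℕ} (σ : ℝ → Fin m) : Prop where
  right_continuous : ∀ t, 0 ≤ t → ContinuousWithinAt σ (Ici t) t
  locally_finite : ∀ b : ℝ, (discontinuities σ ∩ Iic b).Finite

/-- `σ` has average dwell-time `τ` and chatter bound `N`. -/
def HasAverageDwellTime {m : ℕ} (τ : ℝ) (N : ℕ) (σ : ℝ → Fin m) : Prop :=
  ∀ a b : ℝ, 0 ≤ a → a < b →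
    ((discontinuities σ ∩ Ioo a b).ncard : ℝ) ≤ N + (b - a) / τ

/-! ### Solutions and trajectories -/

/-- The intervals `[0, T)`, `[0, T]` with `0 < T < ∞`, and `[0, ∞)`. -/
def IsTimeInterval (I : Set ℝ) : Prop :=
  (∃ T : ℝ, 0 < T ∧ (I = Ico 0 T ∨ I = Icc 0 T)) ∨ I = Ici 0

/-- `x` is a solution on `I` of `x' = f_σ(x)`: it is continuous on `I` and satisfies the equation
at all times of `I` that are not switching times. The derivative is taken within `I`, that is,
it is one-sided at a right end point belonging to `I`. -/
structure IsSolution {n m : ℕ}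
    (f : Fin m → EuclideanSpace ℝ (Fin n) → EuclideanSpace ℝ (Fin n))
    (σ : ℝ → Fin m) (I : Set ℝ) (x : ℝ → EuclideanSpace ℝ (Fin n)) : Prop where
  continuousOn : ContinuousOn x I
  hasDeriv : ∀ t ∈ I, t ∉ switchingTimes σ → HasDerivWithinAt x (f (σ t) (x t)) I t

/-- The data of a pair `(x, σ)` together with the end point `T ∈ (0, ∞]` of the domain `[0, T)`
of `x`. Values of `x` outside of the domain play no role. -/
structure Traj (n m : ℕ) where
  /-- the curve -/
  x : ℝ → EuclideanSpace ℝ (Fin n)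
  /-- the switching signal -/
  σ : ℝ → Fin m
  /-- the end point of the domain -/
  T : EReal

/-- The domain `[0, T)`. -/
def Traj.dom {n m : ℕ} (p : Traj n m) : Set ℝ :=
  {t | 0 ≤ t ∧ (t : EReal) < p.T}

/-- `p` is a maximal trajectory: `p.σ` is a switching signal, and `p.x` is a solution on
`[0, T)` that has no extension to a solution on a larger interval. -/
structure Traj.IsMaximal {n m : ℕ}
    (f : Fin m → EuclideanSpace ℝ (Fin n) → EuclideanSpace ℝ (Fin n))
    (p : Traj n m) : Prop where
  isSwitchingSignal : IsSwitchingSignal p.σ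
  pos : 0 < p.T
  isSolution : IsSolution f p.σ p.dom p.x
  not_extendable : ∀ (J : Set ℝ) (y : ℝ → EuclideanSpace ℝ (Fin n)),
    IsTimeInterval J → IsSolution f p.σ J y → p.dom ⊆ J → EqOn p.x y p.dom → J ⊆ p.dom

/-- All maximal trajectories. -/
def maximalTrajs {n m : ℕ}
    (f : Fin m → EuclideanSpace ℝ (Fin n) → EuclideanSpace ℝ (Fin n)) : Set (Traj n m) :=
  {p | p.IsMaximal f}

/-- `𝒯[χ]`: the maximal trajectories with `x(t) ∈ χ_{σ(t)}`. -/
def coveredTrajs {n m : ℕ}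
    (f : Fin m → EuclideanSpace ℝ (Fin n) → EuclideanSpace ℝ (Fin n))
    (χ : Fin m → Set (EuclideanSpace ℝ (Fin n))) : Set (Traj n m) :=
  {p ∈ maximalTrajs f | ∀ t ∈ p.dom, p.x t ∈ χ (p.σ t)}

/-- `𝒯_a[τ, N]`: the maximal trajectories whose signal has average dwell-time `τ` and chatter
bound `N`. -/
def dwellTrajs {n m : ℕ}
    (f : Fin m → EuclideanSpace ℝ (Fin n) → EuclideanSpace ℝ (Fin n))
    (τ : ℝ) (N : ℕ) : Set (Traj n m) :=
  {p ∈ maximalTrajs f | HasAverageDwellTime τ N p.σ}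

/-- `𝒯_a`: the union of the `𝒯_a[τ, N]` over `τ > 0` and `N > 0`. -/
def averageDwellTrajs {n m : ℕ}
    (f : Fin m → EuclideanSpace ℝ (Fin n) → EuclideanSpace ℝ (Fin n)) : Set (Traj n m) :=
  {p | ∃ (τ : ℝ) (N : ℕ), 0 < τ ∧ 0 < N ∧ p ∈ dwellTrajs f τ N}

/-- `𝒯_V`: `V(x, σ)` does not increase between times with the same mode. -/
def nonincreasingTrajs {n m : ℕ}
    (f : Fin m → EuclideanSpace ℝ (Fin n) → EuclideanSpace ℝ (Fin n))
    (V : EuclideanSpace ℝ (Fin n) → Fin m → ℝ) : Set (Traj n m) :=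
  {p ∈ maximalTrajs f | ∀ t ∈ p.dom, ∀ t' ∈ p.dom, t ≤ t' → p.σ t = p.σ t' →
    V (p.x t') (p.σ t') ≤ V (p.x t) (p.σ t)}

/-- `𝒯_V^*`: the members of `𝒯_V` for which `V(x, σ)` is the same at all times with the same
mode. -/
def constantTrajs {n m : ℕ}
    (f : Fin m → EuclideanSpace ℝ (Fin n) → EuclideanSpace ℝ (Fin n))
    (V : EuclideanSpace ℝ (Fin n) → Fin m → ℝ) : Set (Traj n m) :=
  {p ∈ nonincreasingTrajs f V | ∀ t ∈ p.dom, ∀ t' ∈ p.dom, p.σ t = p.σ t' →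
    V (p.x t) (p.σ t) = V (p.x t') (p.σ t')}

/-! ### Coverings, weak Lyapunov-like functions, weak invariance -/

/-- `χ` is a covering of `ℝⁿ` by closed sets. -/
structure IsClosedCovering {n m : ℕ} (χ : Fin m → Set (EuclideanSpace ℝ (Fin n))) : Prop where
  isClosed : ∀ γ, IsClosed (χ γ)
  covers : ⋃ γ, χ γ = univ

/-- `Γ*`: the modes `γ` with `0 ∈ χ_γ`. -/
def zeroModes {n m : ℕ} (χ : Fin m → Set (EuclideanSpace ℝ (Fin n))) : Set (Fin m) :=
  {γ | 0 ∈ χ γ}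

/-- `V` is a weak Lyapunov-like function for the family `F`. In `switch`, `s` and `t` are
switching times `t_i < t_j` (in the domain) and `u` is `t_{i+1}`. -/
structure IsWeakLyapunovLike {n m : ℕ}
    (f : Fin m → EuclideanSpace ℝ (Fin n) → EuclideanSpace ℝ (Fin n))
    (χ : Fin m → Set (EuclideanSpace ℝ (Fin n)))
    (F : Set (Traj n m)) (V : EuclideanSpace ℝ (Fin n) → Fin m → ℝ) : Prop where
  contDiff : ∀ γ, ContDiff ℝ 1 (fun ξ => V ξ γ)
  bounds : ∃ α₁ α₂ : ℝ≥0 → ℝ≥0, IsClassKInfty α₁ ∧ IsClassKInfty α₂ ∧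
    ∀ γ, ∀ ξ ∈ χ γ, (α₁ ‖ξ‖₊ : ℝ) ≤ V ξ γ ∧ V ξ γ ≤ (α₂ ‖ξ‖₊ : ℝ)
  deriv_nonpos : ∀ γ, ∀ ξ ∈ χ γ, fderiv ℝ (fun ζ => V ζ γ) ξ (f γ ξ) ≤ 0
  switch : ∀ p ∈ F, ∀ s ∈ switchingTimes p.σ, ∀ t ∈ switchingTimes p.σ, t ∈ p.dom → s < t →
    p.σ s = p.σ t → ∀ u, IsLeast {u | u ∈ switchingTimes p.σ ∧ s < u} u →
    V (p.x t) (p.σ t) ≤ V (p.x u) (p.σ s)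

/-- `M` is weakly invariant with respect to the family `F`. -/
def IsWeaklyInvariant {n m : ℕ} (F : Set (Traj n m))
    (M : Set (EuclideanSpace ℝ (Fin n) × Fin m)) : Prop :=
  M.Nonempty ∧ ∀ q ∈ M, ∃ p ∈ F, p.x 0 = q.1 ∧ p.σ 0 = q.2 ∧ ∀ t ∈ p.dom, (p.x t, p.σ t) ∈ M

/-- `M` is the maximal (largest) weakly invariant set with respect to `F`. -/
def IsMaximalWeaklyInvariant {n m : ℕ} (F : Set (Traj n m))
    (M : Set (EuclideanSpace ℝ (Fin n) × Fin m)) : Prop :=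
  IsGreatest {M' | IsWeaklyInvariant F M'} M

/-! ### Stability

The estimates are for all `t ≥ t₀ ≥ 0`, so that the members of a stable family have to be
defined on all of `[0, ∞)`; this is stated explicitly. -/

/-- Uniform stability of a family. -/
def UniformlyStable {n m : ℕ} (F : Set (Traj n m)) : Prop :=
  ∃ α : ℝ≥0 → ℝ≥0, IsClassKInfty α ∧ ∀ p ∈ F, p.T = ⊤ ∧
    ∀ t₀ t : ℝ, 0 ≤ t₀ → t₀ ≤ t → ‖p.x t‖₊ ≤ α ‖p.x t₀‖₊

/-- Global asymptotic stability of a family. -/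
def GloballyAsymptoticallyStable {n m : ℕ} (F : Set (Traj n m)) : Prop :=
  UniformlyStable F ∧ ∀ p ∈ F, p.T = ⊤ ∧ Tendsto p.x atTop (𝓝 0)

/-- Global uniform asymptotic stability of a family. -/
def GloballyUniformlyAsymptoticallyStable {n m : ℕ} (F : Set (Traj n m)) : Prop :=
  ∃ β : ℝ≥0 → ℝ≥0 → ℝ≥0, IsClassKL β ∧ ∀ p ∈ F, p.T = ⊤ ∧
    ∀ t₀ t : ℝ, 0 ≤ t₀ → t₀ ≤ t → ‖p.x t‖₊ ≤ β ‖p.x t₀‖₊ (t - t₀).toNNReal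

end Switched

namespace Switched

/-! ### Comparison functions -/

/-! The proof is a LaSalle argument for a class of trajectories that is closed under time shifts and
limits. The family `F` need not be closed in this way, so it is replaced by a larger class. Since
`V` decreases along arcs of constant mode, the condition at switching times upgrades to: `V(x, σ)`
does not increase between any two times with the same mode
(`IsWeakLyapunovLike.subset_nonincreasingTrajs`). From then on one works in 𝒯_V ∩ 𝒯[χ], intersected
with 𝒯_a[τ, N] where compactness is needed.

Stability: for equal modes the bounds on `V` give |x(t)| ≤ ρ(|x(s)|). Following a trajectory up to
the last time its initial mode is active removes that mode from the rest, so m applications of ρ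
suffice (`nnnorm_le_iterate_of_mode_mem`). Bounded maximal trajectories are global.

Compactness: along an ultrafilter, bounded trajectories with common τ and N converge to a trajectory
of the same class (`exists_limit_trajectory`). The dwell-time bound keeps the limits of switching
times locally finite, and away from them the modes stabilise.

Attractivity: if x(s_k) stays away from 0 with s_k → ∞, the shifts by s_k have a limit q along which
`V` is constant in each mode. The orbit of q is weakly invariant, hence lies over 0, a
contradiction. Uniformity follows from a second limit: trajectories that fail to become small within
time k have a limit bounded away from 0, against the convergence already proved. Stability and
uniform attractivity combine into a KL estimate. -/

theorem IsClassKInfty.surjective {α : ℝ≥0 → ℝ≥0} (h : IsClassKInfty α) :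
    Function.Surjective α := by
  intro y
  have : ∃ x, y ≤ α x := by
    by_contra! hc
    exact h.unbounded ⟨y, by rintro _ ⟨x, rfl⟩; exact (hc x).le⟩
  exact mem_range_of_exists_le_of_exists_ge h.continuous ⟨0, by simp [h.map_zero]⟩ this

/-- A strictly increasing surjection is an order isomorphism of `ℝ≥0`, hence continuous and
bottom-preserving. Stability of the class under composition, iteration and inversion then reduces to
surjectivity. -/
theorem IsClassKInfty.of_surjective {α : ℝ≥0 → ℝ≥0} (h : StrictMono α)
    (h' : Function.Surjective α) : IsClassKInfty α where
  strictMono := h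
  continuous := (h.orderIsoOfSurjective α h').continuous
  map_zero := (h.orderIsoOfSurjective α h').map_bot
  unbounded := by
    rw [h'.range_eq]
    exact not_bddAbove_univ

theorem IsClassKInfty.comp {α β : ℝ≥0 → ℝ≥0} (hα : IsClassKInfty α) (hβ : IsClassKInfty β) :
    IsClassKInfty (α ∘ β) :=
  .of_surjective (hα.strictMono.comp hβ.strictMono) (hα.surjective.comp hβ.surjective)

theorem IsClassKInfty.iterate {α : ℝ≥0 → ℝ≥0} (hα : IsClassKInfty α) (k : ℕ) :
    IsClassKInfty α^[k] :=
  .of_surjective (hα.strictMono.iterate k) (hα.surjective.iterate k)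

theorem IsClassKInfty.max {α β : ℝ≥0 → ℝ≥0} (hα : IsClassKInfty α) (hβ : IsClassKInfty β) :
    IsClassKInfty (fun r => max (α r) (β r)) where
  strictMono := fun _ _ h => max_lt_max (hα.strictMono h) (hβ.strictMono h)
  continuous := hα.continuous.max hβ.continuous
  map_zero := by simp [hα.map_zero, hβ.map_zero]
  unbounded := by
    rintro ⟨c, hc⟩
    refine hα.unbounded ⟨c, ?_⟩
    rintro _ ⟨r, rfl⟩
    exact (le_max_left _ _).trans (hc ⟨r, rfl⟩)

/-- A bound `α₁ a ≤ α₂ b` is the same as a bound of `a` by a function of `b`. -/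
theorem IsClassKInfty.exists_gain {α₁ α₂ : ℝ≥0 → ℝ≥0} (h₁ : IsClassKInfty α₁)
    (h₂ : IsClassKInfty α₂) :
    ∃ ρ, IsClassKInfty ρ ∧ (∀ r, r ≤ ρ r) ∧ ∀ a b, α₁ a ≤ α₂ b → a ≤ ρ b := by
  let e := h₁.strictMono.orderIsoOfSurjective α₁ h₁.surjective
  have he : IsClassKInfty e.symm := .of_surjective e.symm.strictMono e.symm.surjective
  -- Taking the maximum with `α₁` before inverting `α₁` is what gives `r ≤ ρ r`.
  refine ⟨_, he.comp (h₁.max h₂), fun r => ?_, fun a b hab => ?_⟩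
  · exact (e.le_symm_apply).2 (le_max_left _ _)
  · exact (e.le_symm_apply).2 (hab.trans (le_max_right _ _))

/-- A nonnegative function that is monotone in `r`, antitone in `s`, bounded by a function of
class `K_∞` and tends to zero with `s → ∞` has an upper bound of class `KL`. -/
theorem exists_classKL_ge {α : ℝ≥0 → ℝ≥0} (hα : IsClassKInfty α) {φ : ℝ → ℝ → ℝ}
    (h0 : ∀ r s, 0 ≤ φ r s) (hmono : ∀ s, Monotone fun r => φ r s) (hanti : ∀ r, Antitone (φ r))
    (hle : ∀ r s, φ r s ≤ α r.toNNReal) (hlim : ∀ r, Tendsto (φ r) atTop (𝓝 0)) :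
    ∃ β, IsClassKL β ∧ ∀ r s : ℝ≥0, φ r s ≤ β r s := by
  -- The mean of `φ` over `[r, 2r]`: it dominates `φ r s` by monotonicity, is at most `φ (2r) s`,
  -- and is continuous in `r` although `φ` may jump.
  set h : ℝ → ℝ → ℝ := fun r s => ∫ u in (1 : ℝ)..2, φ (r * u) s with hh
  have hint : ∀ s r : ℝ, 0 ≤ r → IntervalIntegrable (fun u => φ (r * u) s) MeasureTheory.volume 1 2 :=
    fun s r hr => Monotone.intervalIntegrable fun u v huv =>
      hmono s (mul_le_mul_of_nonneg_left huv hr)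
  have hconst : ∀ c : ℝ, ∫ _ in (1 : ℝ)..2, c = c := fun c => by norm_num
  have hge : ∀ r s, 0 ≤ r → φ r s ≤ h r s := fun r s hr => by
    rw [← hconst (φ r s)]
    refine intervalIntegral.integral_mono_on (by norm_num) (by simp) (hint s r hr) fun u hu => ?_
    exact hmono s (le_mul_of_one_le_right hr hu.1)
  have hub : ∀ r s, 0 ≤ r → h r s ≤ φ (r * 2) s := fun r s hr => by
    rw [← hconst (φ (r * 2) s)]
    refine intervalIntegral.integral_mono_on (by norm_num) (hint s r hr) (by simp) fun u hu => ?_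
    exact hmono s (mul_le_mul_of_nonneg_left hu.2 hr)
  have hnn : ∀ r s, 0 ≤ r → 0 ≤ h r s := fun r s hr => (h0 r s).trans (hge r s hr)
  have hmon : ∀ r r' s, 0 ≤ r → r ≤ r' → h r s ≤ h r' s := fun r r' s hr hrr =>
    intervalIntegral.integral_mono_on (by norm_num) (hint s r hr) (hint s r' (hr.trans hrr))
      fun u hu => hmono s (mul_le_mul_of_nonneg_right hrr (by linarith [hu.1]))
  have hant : ∀ r s s', 0 ≤ r → s ≤ s' → h r s' ≤ h r s := fun r s s' hr hss =>
    intervalIntegral.integral_mono_on (by norm_num) (hint s' r hr) (hint s r hr)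
      fun u _ => hanti _ hss
  have hz : ∀ s, h 0 s = 0 := fun s => by
    refine le_antisymm ((hub 0 s le_rfl).trans ((hle _ _).trans ?_)) (hnn 0 s le_rfl)
    simp [hα.map_zero]
  have hcont : ∀ s, ContinuousOn (fun r => h r s) (Ici 0) := by
    intro s r hr
    rcases (mem_Ici.1 hr).eq_or_lt with rfl | hr0
    · rw [ContinuousWithinAt, hz]
      have hlim0 : Tendsto (fun r : ℝ => (α (r * 2).toNNReal : ℝ)) (𝓝[Ici 0] 0) (𝓝 0) := by
        have : Continuous fun r : ℝ => (α (r * 2).toNNReal : ℝ) :=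
          NNReal.continuous_coe.comp (hα.continuous.comp
            (continuous_real_toNNReal.comp (continuous_mul_const 2)))
        have h1 := this.tendsto 0
        simp only [zero_mul, Real.toNNReal_zero, hα.map_zero, NNReal.coe_zero] at h1
        exact h1.mono_left nhdsWithin_le_nhds
      refine squeeze_zero' ?_ ?_ hlim0
      · filter_upwards [self_mem_nhdsWithin] with r hr using hnn r s hr
      · filter_upwards [self_mem_nhdsWithin] with r hr using (hub r s hr).trans (hle _ _)
    · have hprim : Continuous fun b => ∫ u in (0 : ℝ)..b, φ u s :=
        intervalIntegral.continuous_primitive (fun a b => (hmono s).intervalIntegrable) 0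
      -- Away from 0, the substitution `u ↦ r u` writes the mean through a primitive, which is
      -- continuous.
      have hev : (fun r => h r s) =ᶠ[𝓝 r]
          fun r => r⁻¹ * ((∫ u in (0 : ℝ)..(r * 2), φ u s) - ∫ u in (0 : ℝ)..r, φ u s) := by
        filter_upwards [lt_mem_nhds hr0] with r hr
        simp only [hh]
        rw [intervalIntegral.integral_comp_mul_left (fun u => φ u s) hr.ne',
          intervalIntegral.integral_interval_sub_left (hmono s).intervalIntegrable
          (hmono s).intervalIntegrable, mul_one, smul_eq_mul]
      refine ContinuousAt.continuousWithinAt (ContinuousAt.congr ?_ hev.symm)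
      refine (continuousAt_inv₀ hr0.ne').mul (ContinuousAt.sub ?_ hprim.continuousAt)
      exact (hprim.comp (continuous_mul_const 2)).continuousAt
  -- The summand `r / (1 + s)` makes the bound strictly increasing and unbounded in `r`, and still
  -- tends to zero in `s`.
  refine ⟨fun r s => (h r s).toNNReal + r / (1 + s), ⟨fun s => ⟨?_, ?_, ?_, ?_⟩, ?_, ?_⟩, ?_⟩
  · refine Monotone.add_strictMono (fun r r' hrr => ?_) fun r r' hrr => ?_
    · exact Real.toNNReal_le_toNNReal (hmon _ _ _ r.2 hrr)
    · exact div_lt_div_of_pos_right hrr (by positivity)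
  · refine Continuous.add ?_ (continuous_id.div_const _)
    refine continuous_real_toNNReal.comp ?_
    exact (hcont s).comp_continuous NNReal.continuous_coe fun r => r.2
  · simp [hz]
  · rintro ⟨c, hc⟩
    have hc1 := hc ⟨(c + 1) * (1 + s), rfl⟩
    have : (c + 1) * (1 + s) / (1 + s) = c + 1 := by
      field_simp
    simp only [this] at hc1
    have h2 : c + 1 ≤ c := le_trans (le_add_of_nonneg_left zero_le) hc1
    exact absurd h2 (not_le.2 (lt_add_one c))
  · intro r s s' hss
    refine add_le_add (Real.toNNReal_le_toNNReal (hant _ _ _ r.2 hss)) ?_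
    exact div_le_div_of_nonneg_left zero_le (by positivity) (by gcongr)
  · intro r
    have h1 : Tendsto (fun s : ℝ≥0 => (h r s).toNNReal) atTop (𝓝 0) := by
      have : Tendsto (fun s : ℝ≥0 => h r s) atTop (𝓝 0) :=
        squeeze_zero (fun s => hnn r s r.2) (fun s => hub r s r.2)
          ((hlim _).comp (NNReal.tendsto_coe_atTop.2 tendsto_id))
      simpa using tendsto_real_toNNReal this
    have h2 : Tendsto (fun s : ℝ≥0 => r / (1 + s)) atTop (𝓝 0) := by
      rw [← NNReal.tendsto_coe]
      push_cast
      exact Tendsto.div_atTop tendsto_const_nhds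
        (tendsto_atTop_add_const_left _ _ (NNReal.tendsto_coe_atTop.2 tendsto_id))
    simpa using h1.add h2
  · intro r s
    push_cast
    refine (hge r s r.2).trans ((Real.le_coe_toNNReal _).trans ?_)
    exact le_add_of_nonneg_right (by positivity)

variable {n m : ℕ} {f : Fin m → EuclideanSpace ℝ (Fin n) → EuclideanSpace ℝ (Fin n)}
  {χ : Fin m → Set (EuclideanSpace ℝ (Fin n))} {V : EuclideanSpace ℝ (Fin n) → Fin m → ℝ}
  {σ : ℝ → Fin m} {p : Traj n m}

/-! ### Switching signals -/

theorem IsSwitchingSignal.eventually_eq_right (hσ : IsSwitchingSignal σ) {t : ℝ} (ht : 0 ≤ t) :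
    ∀ᶠ s in 𝓝[≥] t, σ s = σ t := by
  have := hσ.right_continuous t ht
  rw [ContinuousWithinAt, nhds_discrete (Fin m), tendsto_pure] at this
  exact this

theorem eventually_eq_of_notMem_discontinuities {t : ℝ} (ht : 0 < t)
    (h : t ∉ discontinuities σ) : ∀ᶠ s in 𝓝 t, σ s = σ t := by
  have : ContinuousAt σ t := by
    by_contra hc
    exact h ⟨ht, hc⟩
  rw [ContinuousAt, nhds_discrete (Fin m), tendsto_pure] at this
  exact this

theorem IsSwitchingSignal.finite_switchingTimes (hσ : IsSwitchingSignal σ) (b : ℝ) :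
    (switchingTimes σ ∩ Iic b).Finite :=
  ((hσ.locally_finite b).insert 0).subset fun _ hx => hx.1.imp id fun h => ⟨h, hx.2⟩

theorem eventually_notMem_of_finite_inter_Iic {S : Set ℝ} (h : ∀ b, (S ∩ Iic b).Finite) (t : ℝ) :
    ∀ᶠ s in 𝓝[≠] t, s ∉ S := by
  have h1 : ((S ∩ Iic (t + 1)) \ {t})ᶜ ∈ 𝓝 t :=
    (h (t + 1)).sdiff.isClosed.isOpen_compl.mem_nhds (by simp)
  filter_upwards [mem_nhdsWithin_of_mem_nhds h1,
    mem_nhdsWithin_of_mem_nhds (gt_mem_nhds (lt_add_one t)), self_mem_nhdsWithin] with s hs hs1 hs2 h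
  exact hs ⟨⟨h, le_of_lt hs1⟩, hs2⟩

theorem IsSwitchingSignal.eventually_notMem (hσ : IsSwitchingSignal σ) (t : ℝ) :
    ∀ᶠ s in 𝓝[≠] t, s ∉ switchingTimes σ :=
  eventually_notMem_of_finite_inter_Iic hσ.finite_switchingTimes t

theorem IsSwitchingSignal.eq_of_forall_notMem (hσ : IsSwitchingSignal σ) {a b : ℝ} (ha : 0 ≤ a)
    (hab : a ≤ b) (h : ∀ u, a < u → u ≤ b → u ∉ discontinuities σ) : σ b = σ a := by
  refine isPreconnected_Icc.constant (s := Icc a b) (fun u hu => ?_) (right_mem_Icc.2 hab)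
    (left_mem_Icc.2 hab)
  rcases hu.1.eq_or_lt with rfl | hau
  · exact (hσ.right_continuous _ ha).mono Icc_subset_Ici_self
  · refine ContinuousAt.continuousWithinAt ?_
    by_contra hc
    exact h u hau hu.2 ⟨ha.trans_lt hau, hc⟩

/-! ### Domains -/

theorem Traj.mem_dom_of_le {s t : ℝ} (ht : t ∈ p.dom) (hs : 0 ≤ s) (hst : s ≤ t) : s ∈ p.dom :=
  ⟨hs, (EReal.coe_le_coe_iff.2 hst).trans_lt ht.2⟩

theorem Traj.eventually_lt {t : ℝ} (ht : t ∈ p.dom) : ∀ᶠ s : ℝ in 𝓝 t, (s : EReal) < p.T :=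
  (isOpen_Iio.preimage continuous_coe_real_ereal).mem_nhds ht.2

theorem Traj.dom_mem_nhds {t : ℝ} (ht : t ∈ p.dom) (h : 0 < t) : p.dom ∈ 𝓝 t := by
  filter_upwards [Traj.eventually_lt ht, lt_mem_nhds h] with s hs hs0 using ⟨hs0.le, hs⟩

theorem Traj.dom_mem_nhdsGE {t : ℝ} (ht : t ∈ p.dom) : p.dom ∈ 𝓝[≥] t := by
  filter_upwards [mem_nhdsWithin_of_mem_nhds (Traj.eventually_lt ht), self_mem_nhdsWithin]
    with s hs hs0 using ⟨ht.1.trans hs0, hs⟩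

theorem Traj.dom_eq_Ici (h : p.T = ⊤) : p.dom = Ici 0 := by
  ext t
  simp [Traj.dom, h]

theorem Traj.Icc_subset_dom {a b : ℝ} (ha : 0 ≤ a) (hb : b ∈ p.dom) : Icc a b ⊆ p.dom :=
  fun _ hu => Traj.mem_dom_of_le hb (ha.trans hu.1) hu.2

/-! ### Solutions -/

theorem hasDerivAt_of_notMem_switchingTimes (hx : IsSolution f p.σ p.dom p.x) {t : ℝ}
    (ht : t ∈ p.dom) (h : t ∉ switchingTimes p.σ) : HasDerivAt p.x (f (p.σ t) (p.x t)) t := by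
  have h0 : 0 < t := ht.1.lt_of_ne fun h0 => h (Or.inl h0.symm)
  exact (hx.hasDeriv t ht h).hasDerivAt (Traj.dom_mem_nhds ht h0)

/-- A solution has the expected right derivative at all times, switching or not. -/
theorem hasDerivWithinAt_Ici (hf : ∀ γ, Continuous (f γ)) (hσ : IsSwitchingSignal p.σ)
    (hx : IsSolution f p.σ p.dom p.x) {t : ℝ} (ht : t ∈ p.dom) :
    HasDerivWithinAt p.x (f (p.σ t) (p.x t)) (Ici t) t := by
  have hev : ∀ᶠ u in 𝓝[>] t, u ∈ p.dom ∧ u ∉ switchingTimes p.σ ∧ p.σ u = p.σ t := by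
    filter_upwards [nhdsWithin_mono t Ioi_subset_Ici_self (Traj.dom_mem_nhdsGE ht),
      nhdsWithin_mono t (fun u hu => ne_of_gt hu) (hσ.eventually_notMem t),
      nhdsWithin_mono t Ioi_subset_Ici_self (hσ.eventually_eq_right ht.1)] with u h1 h2 h3
      using ⟨h1, h2, h3⟩
  have hd : ∀ᶠ u in 𝓝[>] t, deriv p.x u = f (p.σ t) (p.x u) := by
    filter_upwards [hev] with u hu
    rw [(hasDerivAt_of_notMem_switchingTimes hx hu.1 hu.2.1).deriv, hu.2.2]
  have hc : ContinuousWithinAt p.x (Ici t) t :=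
    (hx.continuousOn t ht).mono_of_mem_nhdsWithin (Traj.dom_mem_nhdsGE ht)
  refine hasDerivWithinAt_Ici_of_tendsto_deriv
    (s := {u | u ∈ p.dom ∧ u ∉ switchingTimes p.σ ∧ p.σ u = p.σ t}) (fun u hu => ?_) ?_ hev ?_
  · exact (hasDerivAt_of_notMem_switchingTimes hx hu.1 hu.2.1).differentiableAt.differentiableWithinAt
  · exact (hx.continuousOn t ht).mono fun u hu => hu.1
  · refine Tendsto.congr' (hd.mono fun _ h => h.symm) ?_
    exact ((hf _).tendsto _).comp (hc.mono Ioi_subset_Ici_self)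

theorem exists_bound_on_ball (hf : ∀ γ, Continuous (f γ)) (R : ℝ) :
    ∃ C : ℝ≥0, ∀ γ ξ, ‖ξ‖ ≤ R → ‖f γ ξ‖ ≤ C := by
  have h : ∀ γ, ∃ C : ℝ, ∀ ξ, ‖ξ‖ ≤ R → ‖f γ ξ‖ ≤ C := fun γ => by
    obtain ⟨C, hC⟩ := (isCompact_closedBall (0 : EuclideanSpace ℝ (Fin n)) R).exists_bound_of_continuousOn
      (hf γ).continuousOn
    exact ⟨C, fun ξ hξ => hC ξ (by simpa using hξ)⟩
  choose C hC using h
  obtain ⟨B, hB⟩ := (finite_range C).bddAbove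
  exact ⟨B.toNNReal, fun γ ξ hξ => (hC γ ξ hξ).trans ((hB ⟨γ, rfl⟩).trans (Real.le_coe_toNNReal B))⟩

/-- The right derivative satisfies the equation even at switching times, so the mean value
inequality applies across switchings without subdividing the interval. -/
theorem lipschitzOnWith_of_bound (hf : ∀ γ, Continuous (f γ)) (hσ : IsSwitchingSignal p.σ)
    (hx : IsSolution f p.σ p.dom p.x) {R : ℝ} {C : ℝ≥0} (hC : ∀ γ ξ, ‖ξ‖ ≤ R → ‖f γ ξ‖ ≤ C)
    (hR : ∀ t ∈ p.dom, ‖p.x t‖ ≤ R) : LipschitzOnWith C p.x p.dom := by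
  have key : ∀ s ∈ p.dom, ∀ t ∈ p.dom, s ≤ t → ‖p.x t - p.x s‖ ≤ C * (t - s) := by
    intro s hs t ht hst
    have hsub := Traj.Icc_subset_dom hs.1 ht
    exact norm_image_sub_le_of_norm_deriv_right_le_segment (hx.continuousOn.mono hsub)
      (fun u hu => hasDerivWithinAt_Ici hf hσ hx (hsub (Ico_subset_Icc_self hu)))
      (fun u hu => hC _ _ (hR u (hsub (Ico_subset_Icc_self hu)))) t (right_mem_Icc.2 hst)
  refine LipschitzOnWith.of_dist_le_mul fun s hs t ht => ?_
  rcases le_total s t with h | h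
  · rw [dist_comm, dist_comm s, dist_eq_norm, Real.dist_eq, abs_of_nonneg (sub_nonneg.2 h)]
    exact key s hs t ht h
  · rw [dist_eq_norm, Real.dist_eq, abs_of_nonneg (sub_nonneg.2 h)]
    exact key t ht s hs h

/-- A bounded maximal trajectory is defined for all times. -/
theorem Traj.IsMaximal.T_eq_top (hf : ∀ γ, Continuous (f γ)) (hp : p.IsMaximal f) {R : ℝ}
    (hR : ∀ t ∈ p.dom, ‖p.x t‖ ≤ R) : p.T = ⊤ := by
  by_contra hT
  obtain ⟨T, hTp⟩ : ∃ T : ℝ, p.T = T :=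
    ⟨p.T.toReal, (EReal.coe_toReal hT (bot_le.trans_lt hp.pos).ne').symm⟩
  have hT0 : 0 < T := by simpa [hTp] using hp.pos
  have hdom : p.dom = Ico 0 T := by
    ext t
    simp [Traj.dom, hTp]
  obtain ⟨C, hC⟩ := exists_bound_on_ball hf R
  -- Bounded speed makes `x` Lipschitz on `[0, T)`, so it extends continuously to `T`; the extension
  -- will solve the equation on `[0, T]`, against maximality.
  obtain ⟨y, hy, hxy⟩ :=
    (lipschitzOnWith_of_bound hf hp.isSwitchingSignal hp.isSolution hC hR).extend_finite_dimension
  have hyc : Continuous y := hy.continuous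
  have hσ := hp.isSwitchingSignal
  have hderiv : ∀ t ∈ p.dom, t ∉ switchingTimes p.σ → HasDerivAt y (f (p.σ t) (y t)) t := by
    intro t ht hts
    have h0 : 0 < t := ht.1.lt_of_ne fun h0 => hts (Or.inl h0.symm)
    rw [← hxy ht]
    refine (hasDerivAt_of_notMem_switchingTimes hp.isSolution ht hts).congr_of_eventuallyEq ?_
    filter_upwards [Traj.dom_mem_nhds ht h0] with s hs using (hxy hs).symm
  have hsol : IsSolution f p.σ (Icc 0 T) y := by
    refine ⟨hyc.continuousOn, fun t ht hts => ?_⟩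
    rcases ht.2.eq_or_lt with rfl | htT
    · refine HasDerivWithinAt.mono ?_ (Icc_subset_Iic_self (a := 0))
      have h1 := eventually_eq_of_notMem_discontinuities hT0 fun h => hts (Or.inr h)
      have hev : ∀ᶠ s in 𝓝[<] t, s ∈ p.dom ∧ s ∉ switchingTimes p.σ ∧ p.σ s = p.σ t := by
        filter_upwards [nhdsWithin_mono t (fun u hu => ne_of_lt hu) (hσ.eventually_notMem t),
          mem_nhdsWithin_of_mem_nhds h1, mem_nhdsWithin_of_mem_nhds (lt_mem_nhds hT0),
          self_mem_nhdsWithin] with s h2 h3 h4 h5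
        exact ⟨hdom ▸ ⟨le_of_lt h4, h5⟩, h2, h3⟩
      refine hasDerivWithinAt_Iic_of_tendsto_deriv
        (fun s hs => (hderiv s hs.1 hs.2.1).differentiableAt.differentiableWithinAt)
        hyc.continuousWithinAt hev ?_
      have hd : ∀ᶠ s in 𝓝[<] t, deriv y s = f (p.σ t) (y s) := by
        filter_upwards [hev] with s hs
        rw [(hderiv s hs.1 hs.2.1).deriv, hs.2.2]
      refine Tendsto.congr' (hd.mono fun _ h => h.symm) ?_
      exact (((hf _).comp hyc).tendsto _).mono_left nhdsWithin_le_nhds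
    · exact (hderiv t (hdom ▸ ⟨ht.1, htT⟩) hts).hasDerivWithinAt
  have := hp.not_extendable (Icc 0 T) y (Or.inl ⟨T, hT0, Or.inr rfl⟩) hsol
    (hdom ▸ Ico_subset_Icc_self) hxy (right_mem_Icc.2 hT0.le)
  rw [hdom] at this
  exact lt_irrefl _ this.2

theorem isMaximal_of_T_eq_top (hT : p.T = ⊤) (hσ : IsSwitchingSignal p.σ)
    (hx : IsSolution f p.σ p.dom p.x) : p.IsMaximal f where
  isSwitchingSignal := hσ
  pos := by simp [hT]
  isSolution := hx
  not_extendable := by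
    intro J y hJ _ _ _
    rw [Traj.dom_eq_Ici hT]
    rcases hJ with ⟨T, -, rfl | rfl⟩ | rfl
    · exact Ico_subset_Icc_self.trans Icc_subset_Ici_self
    · exact Icc_subset_Ici_self
    · exact Subset.rfl

/-! ### Monotonicity of `V` along trajectories -/

/-- The mode is prescribed only on `[a, b)`, so `b` may be the next switching time while `V` is
still evaluated in the old mode, as in the switching condition. -/
theorem le_of_forall_mode_eq (hVd : ∀ γ, ContDiff ℝ 1 (fun ξ => V ξ γ))
    (hVn : ∀ γ, ∀ ξ ∈ χ γ, fderiv ℝ (fun ζ => V ζ γ) ξ (f γ ξ) ≤ 0)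
    (hp : p ∈ coveredTrajs f χ) {a b : ℝ} {γ : Fin m} (ha : 0 ≤ a) (hb : b ∈ p.dom) (hab : a ≤ b)
    (h : ∀ u, a ≤ u → u < b → p.σ u = γ) : V (p.x b) γ ≤ V (p.x a) γ := by
  have hsub := Traj.Icc_subset_dom ha hb
  have hder : ∀ u ∈ Ioo a b, HasDerivAt (fun u => V (p.x u) γ)
      (fderiv ℝ (fun ζ => V ζ γ) (p.x u) (f γ (p.x u))) u := by
    intro u hu
    have hev : ∀ᶠ v in 𝓝 u, p.σ v = γ := by
      filter_upwards [Ioo_mem_nhds hu.1 hu.2] with v hv using h v hv.1.le hv.2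
    have hu0 : u ∉ switchingTimes p.σ := by
      rintro (h0 | h0)
      · exact (ha.trans_lt hu.1).ne' h0
      · refine h0.2 ?_
        rw [ContinuousAt, h u hu.1.le hu.2]
        exact tendsto_nhds_of_eventually_eq hev
    have h1 := hasDerivAt_of_notMem_switchingTimes hp.1.isSolution
      (hsub (Ioo_subset_Icc_self hu)) hu0
    rw [h u hu.1.le hu.2] at h1
    exact ((hVd γ).differentiable one_ne_zero (p.x u)).hasFDerivAt.comp_hasDerivAt u h1
  refine antitoneOn_of_deriv_nonpos (f := fun u => V (p.x u) γ) (convex_Icc a b) ?_ ?_ ?_ (left_mem_Icc.2 hab)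
    (right_mem_Icc.2 hab) hab
  · exact (hVd γ).continuous.comp_continuousOn (hp.1.isSolution.continuousOn.mono hsub)
  · rw [interior_Icc]
    exact fun u hu => (hder u hu).differentiableAt.differentiableWithinAt
  · rw [interior_Icc]
    intro u hu
    rw [(hder u hu).deriv]
    refine hVn γ _ ?_
    rw [← h u hu.1.le hu.2]
    exact hp.2 u (hsub (Ioo_subset_Icc_self hu))

/-- The last switching time before `t`. -/
theorem IsSwitchingSignal.exists_isGreatest (hσ : IsSwitchingSignal σ) {t : ℝ} (ht : 0 ≤ t) :
    ∃ s, IsGreatest (switchingTimes σ ∩ Iic t) s :=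
  ⟨_, (hσ.finite_switchingTimes t).isCompact.isGreatest_sSup ⟨0, Or.inl rfl, ht⟩⟩

theorem zero_le_of_mem_switchingTimes {t : ℝ} (ht : t ∈ switchingTimes σ) : 0 ≤ t := by
  rcases ht with rfl | h
  exacts [le_rfl, h.1.le]

/-- Let `s`, `s'` be the last switching times up to `t`, `t'`, and `u` the successor of `s`. If `t`,
`t'` lie in different arcs, `V` decreases from `t` to `u`, from `u` to `s'` by the switching
condition, and from `s'` to `t'`. -/
theorem IsWeakLyapunovLike.subset_nonincreasingTrajs {F : Set (Traj n m)}
    (hV : IsWeakLyapunovLike f χ F V) (hFχ : F ⊆ coveredTrajs f χ) :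
    F ⊆ nonincreasingTrajs f V := by
  intro p hp
  have hpc := hFχ hp
  have hσ := hpc.1.isSwitchingSignal
  refine ⟨hpc.1, fun t ht t' ht' htt hst => ?_⟩
  obtain ⟨s, hs⟩ := hσ.exists_isGreatest ht.1
  obtain ⟨s', hs'⟩ := hσ.exists_isGreatest ht'.1
  have hs0 := zero_le_of_mem_switchingTimes hs.1.1
  have hs0' := zero_le_of_mem_switchingTimes hs'.1.1
  have hconst' : ∀ u, s' ≤ u → u ≤ t' → p.σ u = p.σ s' := fun u hu hut =>
    hσ.eq_of_forall_notMem hs0' hu fun v hv hvu hvd =>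
      (hs'.2 ⟨Or.inr hvd, hvu.trans hut⟩).not_gt hv
  have hσt' := hconst' t' hs'.1.2 le_rfl
  by_cases hst' : s' ≤ t
  · rw [← hst]
    refine le_of_forall_mode_eq hV.contDiff hV.deriv_nonpos hpc ht.1 ht' htt fun u hu hut => ?_
    rw [hconst' u (hst'.trans hu) hut.le, hst, hσt']
  · push Not at hst'
    have hfin : (switchingTimes p.σ ∩ Iic s' ∩ Ioi s).Finite :=
      (hσ.finite_switchingTimes s').inter_of_left _
    have hu := hfin.isCompact.isLeast_sInf ⟨s', ⟨hs'.1.1, self_mem_Iic⟩, hs.1.2.trans_lt hst'⟩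
    set u := sInf (switchingTimes p.σ ∩ Iic s' ∩ Ioi s)
    have hul : IsLeast {u | u ∈ switchingTimes p.σ ∧ s < u} u := by
      refine ⟨⟨hu.1.1.1, hu.1.2⟩, fun v hv => ?_⟩
      rcases le_total v s' with h | h
      · exact hu.2 ⟨⟨hv.1, h⟩, hv.2⟩
      · exact hu.1.1.2.trans h
    have hus' : u ≤ s' := hu.1.1.2
    have htu : t < u := by
      by_contra! h
      exact (hs.2 ⟨hul.1.1, h⟩).not_gt hul.1.2
    have hconst : ∀ v, s ≤ v → v < u → p.σ v = p.σ s := fun v hv hvu =>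
      hσ.eq_of_forall_notMem hs0 hv fun w hw hwv hwd =>
        (hul.2 ⟨Or.inr hwd, hw⟩).not_gt (hwv.trans_lt hvu)
    have hσt := hconst t hs.1.2 htu
    have hsd : s' ∈ p.dom := Traj.mem_dom_of_le ht' hs0' hs'.1.2
    have h1 : V (p.x t') (p.σ s') ≤ V (p.x s') (p.σ s') :=
      le_of_forall_mode_eq hV.contDiff hV.deriv_nonpos hpc hs0' ht' hs'.1.2 fun v hv hvt =>
        hconst' v hv hvt.le
    have h2 := hV.switch p hp s hs.1.1 s' hs'.1.1 hsd (hs.1.2.trans_lt hst')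
      (by rw [← hσt, hst, hσt']) u hul
    have h3 : V (p.x u) (p.σ s) ≤ V (p.x t) (p.σ s) :=
      le_of_forall_mode_eq hV.contDiff hV.deriv_nonpos hpc ht.1
        (Traj.mem_dom_of_le hsd (ht.1.trans htu.le) hus') htu.le
        fun v hv hvt => hconst v (hs.1.2.trans hv) hvt
    rw [hσt', hσt]
    exact h1.trans (h2.trans h3)

/-! ### Stability -/

/-- Induction on the number of available modes: up to the last occurrence of the mode `σ s` one
factor `ρ` is paid, and afterwards that mode is gone. -/
theorem nnnorm_le_iterate_of_mode_mem {ρ : ℝ≥0 → ℝ≥0} (hρ : IsClassKInfty ρ) (hid : ∀ r, r ≤ ρ r)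
    (hx : ContinuousOn p.x p.dom)
    (hmode : ∀ s ∈ p.dom, ∀ t ∈ p.dom, s ≤ t → p.σ s = p.σ t → ‖p.x t‖₊ ≤ ρ ‖p.x s‖₊)
    (G : Finset (Fin m)) : ∀ s ∈ p.dom, ∀ t ∈ p.dom, s ≤ t → (∀ u ∈ Icc s t, p.σ u ∈ G) →
      ‖p.x t‖₊ ≤ ρ^[G.card] ‖p.x s‖₊ := by
  induction hk : G.card generalizing G with
  | zero =>
    intro s _ t _ hst h
    rw [Finset.card_eq_zero] at hk
    simpa [hk] using h s (left_mem_Icc.2 hst)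
  | succ k ih =>
    intro s hs t ht hst h
    set S := {u ∈ Icc s t | p.σ u = p.σ s} with hS
    have hsS : s ∈ S := ⟨left_mem_Icc.2 hst, rfl⟩
    have hlub : IsLUB S (sSup S) := isLUB_csSup ⟨s, hsS⟩ ⟨t, fun u hu => hu.1.2⟩
    set c := sSup S
    have hsc : s ≤ c := hlub.1 hsS
    have hct : c ≤ t := hlub.2 fun u hu => hu.1.2
    have hcd : c ∈ p.dom := Traj.mem_dom_of_le ht (hs.1.trans hsc) hct
    have hSd : S ⊆ p.dom := fun u hu => Traj.mem_dom_of_le ht (hs.1.trans hu.1.1) hu.1.2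
    -- The mode at `c` may differ from `σ s`, so the estimate at `c` is a limit of estimates along
    -- `S`.
    have hc : ‖p.x c‖₊ ≤ ρ ‖p.x s‖₊ := by
      have hcl : c ∈ closure S := hlub.mem_closure ⟨s, hsS⟩
      have hne : (𝓝[S] c).NeBot := mem_closure_iff_nhdsWithin_neBot.1 hcl
      have hlim : Tendsto (fun u => ‖p.x u‖₊) (𝓝[S] c) (𝓝 ‖p.x c‖₊) :=
        ((hx c hcd).mono hSd).nnnorm
      refine le_of_tendsto hlim ?_
      filter_upwards [self_mem_nhdsWithin] with u hu
      exact hmode s hs u (hSd hu) hu.1.1 hu.2.symm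
    rcases hct.eq_or_lt with hct | hct
    · rw [← hct]
      refine hc.trans ?_
      rw [Function.iterate_succ_apply]
      exact Function.id_le_iterate_of_id_le (fun r => hid r) k _
    · rw [Function.iterate_succ_apply]
      refine le_trans ?_ ((hρ.iterate k).strictMono.monotone hc)
      have hsub : Ioo c t ⊆ p.dom := fun u hu =>
        Traj.mem_dom_of_le ht (hcd.1.trans hu.1.le) hu.2.le
      -- The mode `σ s` may still be active at `c` itself, so the induction hypothesis is applied
      -- from `u > c` and then `u → c`.
      have hlim : Tendsto (fun u => ρ^[k] ‖p.x u‖₊) (𝓝[>] c) (𝓝 (ρ^[k] ‖p.x c‖₊)) := by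
        refine ((hρ.iterate k).continuous.tendsto _).comp ?_
        exact (((hx c hcd).mono_of_mem_nhdsWithin (Traj.dom_mem_nhdsGE hcd)).mono
          Ioi_subset_Ici_self).nnnorm
      refine ge_of_tendsto hlim ?_
      filter_upwards [Ioo_mem_nhdsGT hct] with u hu
      refine ih (G.erase (p.σ s)) ?_ u (hsub hu) t ht hu.2.le fun v hv => ?_
      · rw [Finset.card_erase_of_mem (h s (left_mem_Icc.2 hst)), hk, Nat.add_sub_cancel]
      · have hsv : s ≤ v := hsc.trans (hu.1.le.trans hv.1)
        refine Finset.mem_erase.2 ⟨fun hv' => ?_, h v ⟨hsv, hv.2⟩⟩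
        exact (hlub.1 (show v ∈ S from ⟨⟨hsv, hv.2⟩, hv'⟩)).not_gt (hu.1.trans_le hv.1)

/-- Bounds of `V` by functions of class `K_∞`, uniform in the mode. -/
def HasKInftyBounds (χ : Fin m → Set (EuclideanSpace ℝ (Fin n)))
    (V : EuclideanSpace ℝ (Fin n) → Fin m → ℝ) : Prop :=
  ∃ α₁ α₂ : ℝ≥0 → ℝ≥0, IsClassKInfty α₁ ∧ IsClassKInfty α₂ ∧
    ∀ γ, ∀ ξ ∈ χ γ, (α₁ ‖ξ‖₊ : ℝ) ≤ V ξ γ ∧ V ξ γ ≤ (α₂ ‖ξ‖₊ : ℝ)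

theorem HasKInftyBounds.exists_stability_gain (h : HasKInftyBounds χ V) :
    ∃ α, IsClassKInfty α ∧ ∀ p ∈ nonincreasingTrajs f V ∩ coveredTrajs f χ,
      ∀ s ∈ p.dom, ∀ t ∈ p.dom, s ≤ t → ‖p.x t‖₊ ≤ α ‖p.x s‖₊ := by
  obtain ⟨α₁, α₂, h₁, h₂, hb⟩ := h
  obtain ⟨ρ, hρ, hid, hgain⟩ := h₁.exists_gain h₂
  refine ⟨ρ^[(Finset.univ : Finset (Fin m)).card], hρ.iterate _, fun p hp s hs t ht hst => ?_⟩
  refine nnnorm_le_iterate_of_mode_mem hρ hid hp.1.1.isSolution.continuousOn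
    (fun s hs t ht hst hm => hgain _ _ ?_) Finset.univ s hs t ht hst fun _ _ => Finset.mem_univ _
  have := (hb _ _ (hp.2.2 t ht)).1.trans ((hp.1.2 s hs t ht hst hm).trans
    (hb _ _ (hp.2.2 s hs)).2)
  exact_mod_cast this

theorem T_eq_top_of_bounds (hf : ∀ γ, Continuous (f γ)) (h : HasKInftyBounds χ V)
    (hp : p ∈ nonincreasingTrajs f V ∩ coveredTrajs f χ) : p.T = ⊤ := by
  obtain ⟨α, -, hα⟩ := h.exists_stability_gain (f := f)
  have h0 : (0 : ℝ) ∈ p.dom := ⟨le_rfl, by simpa using hp.1.1.pos⟩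
  refine hp.1.1.T_eq_top hf (R := α ‖p.x 0‖₊) fun t ht => ?_
  exact_mod_cast hα p hp 0 h0 t ht ht.1

/-! ### Limits of switching signals along an ultrafilter -/

/-- The positive times around which switchings accumulate along `U`. -/
def limitSwitchings {ι : Type*} (U : Ultrafilter ι) (σs : ι → ℝ → Fin m) : Set ℝ :=
  {t | 0 < t ∧ ∀ W ∈ 𝓝 t, ∀ᶠ k in (U : Filter ι), ∃ s ∈ discontinuities (σs k), s ∈ W}

section Signals

variable {ι : Type*} {U : Ultrafilter ι} {σs : ι → ℝ → Fin m} {τ : ℝ} {N : ℕ}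

/-- Disjoint neighbourhoods of finitely many limit switchings each contain a discontinuity of one
common `σs k`, so their number obeys the bound for that signal. -/
theorem card_le_of_subset_limitSwitchings (hσ : ∀ k, IsSwitchingSignal (σs k))
    (hN : ∀ k, HasAverageDwellTime τ N (σs k)) {a b : ℝ} (ha : 0 ≤ a) (hab : a < b)
    (S : Finset ℝ) (hS : (S : Set ℝ) ⊆ limitSwitchings U σs ∩ Ioo a b) :
    (S.card : ℝ) ≤ N + (b - a) / τ := by
  obtain ⟨W, hW, hdisj⟩ := S.finite_toSet.t2_separation
  have hev : ∀ᶠ k in (U : Filter ι), ∀ t ∈ S,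
      ∃ s ∈ discontinuities (σs k), s ∈ W t ∩ Ioo a b := by
    refine (Finset.eventually_all S).2 fun t ht => ?_
    exact (hS ht).1.2 _ (inter_mem ((hW t).2.mem_nhds (hW t).1)
      (Ioo_mem_nhds (hS ht).2.1 (hS ht).2.2))
  obtain ⟨k, hk⟩ := hev.exists
  choose! g hg using hk
  refine le_trans ?_ (hN k a b ha hab)
  -- Needed because `ncard` of an infinite set is 0.
  have hfin : (discontinuities (σs k) ∩ Ioo a b).Finite :=
    ((hσ k).locally_finite b).subset fun _ h => ⟨h.1, h.2.2.le⟩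
  rw [← Set.ncard_coe_finset]
  refine Nat.cast_le.2 (Set.ncard_le_ncard_of_injOn g
    (fun t ht => ⟨(hg t ht).1, (hg t ht).2.2⟩) (fun t ht t' ht' h => ?_) hfin)
  by_contra hne
  exact (Set.disjoint_left.1 (hdisj ht ht' hne)) (hg t ht).2.1 (h ▸ (hg t' ht').2.1)

theorem finite_limitSwitchings_inter_Ioo (hσ : ∀ k, IsSwitchingSignal (σs k))
    (hN : ∀ k, HasAverageDwellTime τ N (σs k)) {a b : ℝ} (ha : 0 ≤ a) (hab : a < b) :
    (limitSwitchings U σs ∩ Ioo a b).Finite := by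
  by_contra hinf
  obtain ⟨M, hM⟩ := exists_nat_gt (N + (b - a) / τ)
  obtain ⟨S, hS, hcard⟩ := Set.Infinite.exists_subset_card_eq hinf M
  have := card_le_of_subset_limitSwitchings hσ hN ha hab S hS
  rw [hcard] at this
  exact hM.not_ge this

theorem finite_limitSwitchings_inter_Iic (hσ : ∀ k, IsSwitchingSignal (σs k))
    (hN : ∀ k, HasAverageDwellTime τ N (σs k)) (b : ℝ) :
    (limitSwitchings U σs ∩ Iic b).Finite :=
  (finite_limitSwitchings_inter_Ioo hσ hN le_rfl (by positivity : (0 : ℝ) < |b| + 1)).subset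
    fun _ h => ⟨h.1, h.1.1, (h.2.trans (le_abs_self b)).trans_lt (lt_add_one _)⟩

/-- Signals with a common average dwell-time and chatter bound have a limit along `U`. -/
theorem exists_limit_signal (hσ : ∀ k, IsSwitchingSignal (σs k))
    (hN : ∀ k, HasAverageDwellTime τ N (σs k)) :
    ∃ σ : ℝ → Fin m, IsSwitchingSignal σ ∧ HasAverageDwellTime τ N σ ∧
      ∀ t, 0 < t → t ∉ limitSwitchings U σs →
        ∃ ε > 0, ∀ᶠ k in (U : Filter ι), ∀ s ∈ Ioo (t - ε) (t + ε), σs k s = σ t := by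
  set B := limitSwitchings U σs
  have hBfin : ∀ b, (B ∩ Iic b).Finite := finite_limitSwitchings_inter_Iic hσ hN
  -- An ultrafilter on the finite set of modes is principal, so the modes at time `t` have an
  -- eventual value.
  have hlim : ∀ t, ∃ γ, ∀ᶠ k in (U : Filter ι), σs k t = γ := fun t => by
    obtain ⟨γ, hγ⟩ := (U.map fun k => σs k t).eq_pure_of_finite
    refine ⟨γ, ?_⟩
    have : ({γ} : Set (Fin m)) ∈ U.map fun k => σs k t := by rw [hγ]; exact mem_singleton γ
    exact this
  choose κ hκ using hlim
  have hgood : ∀ t, 0 < t → t ∉ B →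
      ∃ ε > 0, ∀ᶠ k in (U : Filter ι), ∀ s ∈ Ioo (t - ε) (t + ε), σs k s = κ t := by
    intro t ht htB
    have : ∃ W ∈ 𝓝 t, ¬ ∀ᶠ k in (U : Filter ι), ∃ s ∈ discontinuities (σs k), s ∈ W := by
      by_contra! hc
      exact htB ⟨ht, hc⟩
    obtain ⟨W, hW, hev⟩ := this
    rw [← Ultrafilter.eventually_not] at hev
    obtain ⟨ε, hε, hball⟩ := Metric.mem_nhds_iff.1 (inter_mem hW (Ioi_mem_nhds ht))
    rw [Real.ball_eq_Ioo] at hball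
    refine ⟨ε, hε, ?_⟩
    filter_upwards [hev, hκ t] with k hk hkt s hs
    rw [← hkt]
    refine isPreconnected_Ioo.constant (fun u hu => ?_) hs ⟨by linarith, by linarith⟩
    refine ContinuousAt.continuousWithinAt ?_
    by_contra hc
    exact hk ⟨u, ⟨(hball hu).2, hc⟩, (hball hu).1⟩
  have hκloc : ∀ t, 0 < t → t ∉ B → ∀ᶠ s in 𝓝 t, κ s = κ t := by
    intro t ht htB
    obtain ⟨ε, hε, hev⟩ := hgood t ht htB
    filter_upwards [Ioo_mem_nhds (sub_lt_self t hε) (lt_add_of_pos_right t hε)] with s hs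
    obtain ⟨k, h1, h2⟩ := (hev.and (hκ s)).exists
    rw [← h2, h1 s hs]
  -- The pointwise limit `κ` may fail to be right-continuous at the points of `B`; the limit signal
  -- is its right limit, which agrees with `κ` at positive times off `B`.
  have hright : ∀ t, ∃ γ, 0 ≤ t → ∀ᶠ s in 𝓝[>] t, κ s = γ := by
    intro t
    by_cases ht : 0 ≤ t
    · have h1 : ∀ᶠ s in 𝓝[>] t, s ∉ B := nhdsWithin_mono t (fun u hu => ne_of_gt hu)
        (eventually_notMem_of_finite_inter_Iic hBfin t)
      obtain ⟨b, hb, hsub⟩ := mem_nhdsGT_iff_exists_Ioo_subset.1 h1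
      have hb' : t < b := hb
      refine ⟨κ ((t + b) / 2), fun _ => ?_⟩
      filter_upwards [Ioo_mem_nhdsGT hb'] with s hs
      refine isPreconnected_Ioo.constant (fun u hu => ?_) hs ⟨by linarith, by linarith⟩
      exact (tendsto_nhds_of_eventually_eq
        (hκloc u (ht.trans_lt hu.1) (hsub hu))).mono_left nhdsWithin_le_nhds
    · exact ⟨κ t, fun h => absurd h ht⟩
  choose σ hσr using hright
  have heq : ∀ t, 0 < t → t ∉ B → σ t = κ t := by
    intro t ht htB
    obtain ⟨s, h1, h2⟩ := ((hσr t ht.le).and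
      (mem_nhdsWithin_of_mem_nhds (hκloc t ht htB) : ∀ᶠ s in 𝓝[>] t, κ s = κ t)).exists
    rw [← h1, h2]
  have hdisc : discontinuities σ ⊆ B := by
    intro t ht
    by_contra htB
    refine ht.2 (tendsto_nhds_of_eventually_eq ?_)
    filter_upwards [hκloc t ht.1 htB, lt_mem_nhds ht.1, eventually_nhdsWithin_iff.1
      (eventually_notMem_of_finite_inter_Iic hBfin t)] with s h1 h2 h3
    by_cases hst : s = t
    · rw [hst]
    · rw [heq s h2 (h3 hst), h1, heq t ht.1 htB]
  refine ⟨σ, ⟨fun t ht => ?_, fun b => (hBfin b).subset (inter_subset_inter_left _ hdisc)⟩,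
    fun a b ha hab => ?_, fun t ht htB => ?_⟩
  · rw [← continuousWithinAt_Ioi_iff_Ici]
    refine tendsto_nhds_of_eventually_eq ?_
    filter_upwards [hσr t ht, self_mem_nhdsWithin, nhdsWithin_mono t (fun u hu => ne_of_gt hu)
        (eventually_notMem_of_finite_inter_Iic hBfin t)] with s h1 h2 h3
    rw [heq s (ht.trans_lt h2) h3, h1]
  · have hfin := finite_limitSwitchings_inter_Ioo (U := U) hσ hN ha hab
    refine le_trans ?_ (card_le_of_subset_limitSwitchings (U := U) hσ hN ha hab hfin.toFinset (by simp))
    rw [← Set.ncard_eq_toFinset_card _ hfin]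
    exact Nat.cast_le.2 (Set.ncard_le_ncard (inter_subset_inter_left _ hdisc) hfin)
  · rw [heq t ht htB]
    exact hgood t ht htB

end Signals

/-! ### Limits of trajectories along an ultrafilter -/

/-- Switchings may accumulate at a time and cancel in the limit. Such a time is not a switching time
of the limit signal, but the equation is first known only around it; the limits of the derivative
from both sides supply it there. -/
theorem hasDerivAt_of_eventually_punctured {E : Type*} [NormedAddCommGroup E] [NormedSpace ℝ E]
    {x g : ℝ → E} {t : ℝ} (hx : ContinuousAt x t) (hg : ContinuousAt g t)
    (h : ∀ᶠ s in 𝓝[≠] t, HasDerivAt x (g s) s) : HasDerivAt x (g t) t := by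
  have hl : ∀ᶠ s in 𝓝[<] t, HasDerivAt x (g s) s := nhdsWithin_mono t (fun u hu => ne_of_lt hu) h
  have hr : ∀ᶠ s in 𝓝[>] t, HasDerivAt x (g s) s := nhdsWithin_mono t (fun u hu => ne_of_gt hu) h
  rw [← hasDerivWithinAt_univ, ← Iic_union_Ici (a := t)]
  refine HasDerivWithinAt.union ?_ ?_
  · exact hasDerivWithinAt_Iic_of_tendsto_deriv
      (fun s hs => (HasDerivAt.differentiableAt hs).differentiableWithinAt) hx.continuousWithinAt hl
      ((hg.tendsto.mono_left nhdsWithin_le_nhds).congr' (hl.mono fun s hs => hs.deriv.symm))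
  · exact hasDerivWithinAt_Ici_of_tendsto_deriv
      (fun s hs => (HasDerivAt.differentiableAt hs).differentiableWithinAt) hx.continuousWithinAt hr
      ((hg.tendsto.mono_left nhdsWithin_le_nhds).congr' (hr.mono fun s hs => hs.deriv.symm))

/-- A pointwise limit of bounded solutions of `x' = g(x)` is a solution. -/
theorem hasDerivAt_of_tendsto_solutions {ι : Type*} {l : Filter ι} [l.NeBot]
    {g : EuclideanSpace ℝ (Fin n) → EuclideanSpace ℝ (Fin n)} (hg : Continuous g) {R : ℝ} {C : ℝ≥0}
    {xs : ι → ℝ → EuclideanSpace ℝ (Fin n)} {x : ℝ → EuclideanSpace ℝ (Fin n)} {t ε : ℝ}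
    (hε : 0 < ε) (hR : ∀ k, ∀ s ∈ Ioo (t - ε) (t + ε), ‖xs k s‖ ≤ R)
    (hC : ∀ ξ, ‖ξ‖ ≤ R → ‖g ξ‖ ≤ C)
    (hd : ∀ᶠ k in l, ∀ s ∈ Ioo (t - ε) (t + ε), HasDerivAt (xs k) (g (xs k s)) s)
    (hlim : ∀ s ∈ Ioo (t - ε) (t + ε), Tendsto (fun k => xs k s) l (𝓝 (x s))) :
    HasDerivAt x (g (x t)) t := by
  have ht : t ∈ Ioo (t - ε) (t + ε) := ⟨by linarith, by linarith⟩
  rw [hasDerivAt_iff_isLittleO, Asymptotics.isLittleO_iff]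
  intro c hc
  have huc := (isCompact_closedBall (0 : EuclideanSpace ℝ (Fin n)) R).uniformContinuousOn_of_continuous
    hg.continuousOn
  obtain ⟨η, hη, hunif⟩ := Metric.uniformContinuousOn_iff.1 huc c hc
  -- Speed at most `C` keeps every solution within `η` of its value at `t` on the `δ`-interval,
  -- uniformly in `k`; the `+ 1` allows `C = 0`.
  have hpos : 0 < η / (C + 1) := by positivity
  set δ := min ε (η / (C + 1))
  have hδ : 0 < δ := lt_min hε hpos
  have hsub : Ioo (t - δ) (t + δ) ⊆ Ioo (t - ε) (t + ε) :=
    Ioo_subset_Ioo (by linarith [min_le_left ε (η / (C + 1))])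
      (by linarith [min_le_left ε (η / (C + 1))])
  have htδ : t ∈ Ioo (t - δ) (t + δ) := ⟨by linarith, by linarith⟩
  filter_upwards [Ioo_mem_nhds htδ.1 htδ.2] with s hs
  have hl : Tendsto (fun k => ‖xs k s - xs k t - (s - t) • g (xs k t)‖) l
      (𝓝 ‖x s - x t - (s - t) • g (x t)‖) :=
    (((hlim s (hsub hs)).sub (hlim t ht)).sub
      ((hg.tendsto _ |>.comp (hlim t ht)).const_smul _)).norm
  refine le_of_tendsto hl ?_
  filter_upwards [hd] with k hk
  have hlip : ∀ u ∈ Ioo (t - δ) (t + δ), dist (xs k u) (xs k t) < η := by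
    intro u hu
    have h1 := Convex.norm_image_sub_le_of_norm_hasDerivWithin_le
      (fun v hv => (hk v (hsub hv)).hasDerivWithinAt) (fun v hv => hC _ (hR k v (hsub hv)))
      (convex_Ioo (t - δ) (t + δ)) htδ hu
    rw [dist_eq_norm]
    refine h1.trans_lt ?_
    have h2 : ‖u - t‖ < δ := by
      rw [Real.norm_eq_abs, abs_lt]
      exact ⟨by linarith [hu.1], by linarith [hu.2]⟩
    calc (C : ℝ) * ‖u - t‖ ≤ (C + 1) * ‖u - t‖ := by gcongr; linarith
      _ < (C + 1) * (η / (C + 1)) := by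
        gcongr
        exact h2.trans_le (min_le_right _ _)
      _ = η := by field_simp
  -- The linearisation error has derivative of norm at most `c`, a bound independent of `k` that
  -- survives the limit.
  have h3 := Convex.norm_image_sub_le_of_norm_hasDerivWithin_le (C := c)
    (f := fun u => xs k u - u • g (xs k t)) (f' := fun u => g (xs k u) - g (xs k t))
    (s := Ioo (t - δ) (t + δ)) (x := t) (y := s) ?_ ?_ (convex_Ioo _ _) htδ hs
  · refine le_of_eq_of_le (congrArg norm ?_) h3
    rw [sub_smul]
    abel
  · intro v hv
    have h4 := (hk v (hsub hv)).sub ((hasDerivAt_id v).smul_const (g (xs k t)))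
    rw [one_smul] at h4
    exact h4.hasDerivWithinAt
  · intro v hv
    rw [← dist_eq_norm]
    exact (hunif _ (by simpa using hR k v (hsub hv)) _ (by simpa using hR k t ht)
      (hlip v hv)).le

/-- Uniformly bounded trajectories with a common average dwell-time and chatter bound have a limit
along `U`, which is a trajectory of the same kind. -/
theorem exists_limit_trajectory {ι : Type*} (U : Ultrafilter ι) (hf : ∀ γ, Continuous (f γ))
    (hχ : ∀ γ, IsClosed (χ γ)) (hV : ∀ γ, Continuous fun ξ => V ξ γ) {τ : ℝ} {N : ℕ}
    {ps : ι → Traj n m}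
    (hp : ∀ k, ps k ∈ nonincreasingTrajs f V ∩ coveredTrajs f χ ∩ dwellTrajs f τ N)
    (hT : ∀ k, (ps k).T = ⊤) {R : ℝ} (hR : ∀ k, ∀ t, 0 ≤ t → ‖(ps k).x t‖ ≤ R) :
    ∃ p ∈ nonincreasingTrajs f V ∩ coveredTrajs f χ ∩ dwellTrajs f τ N, p.T = ⊤ ∧
      (∀ t, 0 ≤ t → Tendsto (fun k => (ps k).x t) U (𝓝 (p.x t))) ∧
      ∀ t, 0 ≤ t → ∀ᶠ s in 𝓝[>] t, ∀ᶠ k in (U : Filter ι), (ps k).σ s = p.σ t := by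
  have hσk : ∀ k, IsSwitchingSignal (ps k).σ := fun k => (hp k).1.1.1.isSwitchingSignal
  have hNk : ∀ k, HasAverageDwellTime τ N (ps k).σ := fun k => (hp k).2.2
  have hdom : ∀ k, (ps k).dom = Ici 0 := fun k => Traj.dom_eq_Ici (hT k)
  obtain ⟨σ, hσ, hσN, hloc⟩ := exists_limit_signal (U := U) hσk hNk
  set B := limitSwitchings U fun k => (ps k).σ
  have hB : ∀ t, ∀ᶠ s in 𝓝[≠] t, s ∉ B :=
    eventually_notMem_of_finite_inter_Iic (finite_limitSwitchings_inter_Iic hσk hNk)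
  obtain ⟨C, hC⟩ := exists_bound_on_ball hf R
  have hlim : ∀ t, ∃ ξ, 0 ≤ t → Tendsto (fun k => (ps k).x t) U (𝓝 ξ) := by
    intro t
    by_cases ht : 0 ≤ t
    · obtain ⟨ξ, -, hξ⟩ := (isCompact_closedBall (0 : EuclideanSpace ℝ (Fin n)) R).ultrafilter_le_nhds
        (U.map fun k => (ps k).x t) (by
          rw [le_principal_iff]
          exact Filter.mem_map.2 (Eventually.of_forall fun k => by simpa using hR k t ht))
      exact ⟨ξ, fun _ => hξ⟩
    · exact ⟨0, fun h => absurd h ht⟩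
  choose x hx using hlim
  have hxc : ContinuousOn x (Ici 0) := by
    refine LipschitzOnWith.continuousOn (K := C) (LipschitzOnWith.of_dist_le_mul fun s hs t ht => ?_)
    refine le_of_tendsto ((hx s hs).dist (hx t ht)) (Eventually.of_forall fun k => ?_)
    exact (lipschitzOnWith_of_bound hf (hσk k) (hp k).1.1.1.isSolution hC
      (fun t ht => hR k t ht.1)).dist_le_mul s (hdom k ▸ hs) t (hdom k ▸ ht)
  have hxr : ∀ t, 0 ≤ t → Tendsto x (𝓝[>] t) (𝓝 (x t)) := fun t ht =>
    (hxc t ht).mono (Ioi_subset_Ici_self.trans (Ici_subset_Ici.2 ht))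
  -- Modes are compared just to the right of `t`: at `t` itself their limit may differ from `σ t` if
  -- switchings accumulate there.
  have hconv : ∀ t, 0 ≤ t → ∀ᶠ s in 𝓝[>] t, ∀ᶠ k in (U : Filter ι), (ps k).σ s = σ t := by
    intro t ht
    filter_upwards [nhdsWithin_mono t (fun u hu => ne_of_gt hu) (hB t),
      nhdsWithin_mono t Ioi_subset_Ici_self (hσ.eventually_eq_right ht), self_mem_nhdsWithin]
      with s h1 h2 h3
    obtain ⟨ε, hε, hev⟩ := hloc s (ht.trans_lt h3) h1
    rw [← h2]
    exact hev.mono fun k hk => hk s ⟨by linarith, by linarith⟩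
  have hderB : ∀ t, 0 < t → t ∉ B → HasDerivAt x (f (σ t) (x t)) t := by
    intro t ht htB
    obtain ⟨ε, hε, hev⟩ := hloc t ht htB
    have hmin : 0 < min ε t := lt_min hε ht
    have hpos : ∀ s ∈ Ioo (t - min ε t) (t + min ε t), 0 < s := fun s hs => by
      linarith [hs.1, min_le_right ε t]
    have hsub : Ioo (t - min ε t) (t + min ε t) ⊆ Ioo (t - ε) (t + ε) :=
      Ioo_subset_Ioo (by linarith [min_le_left ε t]) (by linarith [min_le_left ε t])
    refine hasDerivAt_of_tendsto_solutions (hf (σ t)) hmin (R := R) (C := C)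
      (fun k s hs => hR k s (hpos s hs).le) (hC (σ t)) ?_ (fun s hs => hx s (hpos s hs).le)
    filter_upwards [hev] with k hk s hs
    have hs' := hk s (hsub hs)
    rw [← hs']
    refine hasDerivAt_of_notMem_switchingTimes (hp k).1.1.1.isSolution
      (hdom k ▸ (hpos s hs).le) ?_
    rintro (h0 | h0)
    · exact (hpos s hs).ne' h0
    · refine h0.2 (tendsto_nhds_of_eventually_eq ?_)
      filter_upwards [Ioo_mem_nhds hs.1 hs.2] with u hu
      rw [hk u (hsub hu), hs']
  have hdom' : (⟨x, σ, ⊤⟩ : Traj n m).dom = Ici 0 := Traj.dom_eq_Ici rfl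
  have hmax : (⟨x, σ, ⊤⟩ : Traj n m).IsMaximal f := by
    refine isMaximal_of_T_eq_top rfl hσ ?_
    rw [hdom']
    refine ⟨hxc, fun t ht hts => HasDerivAt.hasDerivWithinAt ?_⟩
    have ht0 : 0 < t := (mem_Ici.1 ht).lt_of_ne fun h0 => hts (Or.inl h0.symm)
    have hev := eventually_eq_of_notMem_discontinuities ht0 fun h => hts (Or.inr h)
    have hxt : ContinuousAt x t := hxc.continuousAt (Ici_mem_nhds ht0)
    refine hasDerivAt_of_eventually_punctured (g := fun s => f (σ t) (x s)) hxt
      ((hf _).continuousAt.comp hxt) ?_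
    filter_upwards [hB t, mem_nhdsWithin_of_mem_nhds hev,
      mem_nhdsWithin_of_mem_nhds (lt_mem_nhds ht0)] with s h1 h2 h3
    rw [← h2]
    exact hderB s h3 h1
  refine ⟨⟨x, σ, ⊤⟩, ⟨⟨⟨hmax, ?_⟩, hmax, ?_⟩, hmax, hσN⟩, rfl, hx, hconv⟩
  · intro t ht t' ht' htt hst
    simp only at hst ⊢
    rcases htt.eq_or_lt with rfl | htt
    · exact le_rfl
    have hs' := hconv t' ht'.1
    rw [← hst] at hs'
    -- Compare at `s > t` and `s' > t'` with `s < t'`, where the modes of the approximants are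
    -- known; then let `k` run along `U`, `s' → t'` and finally `s → t`.
    have key : ∀ᶠ s in 𝓝[>] t, V (x t') (σ t) ≤ V (x s) (σ t) := by
      filter_upwards [hconv t ht.1, Ioo_mem_nhdsGT htt] with s hs hst'
      refine le_of_tendsto (((hV (σ t)).tendsto _).comp (hxr t' ht'.1)) ?_
      filter_upwards [hs', self_mem_nhdsWithin] with s' hs' hst''
      have h0 : 0 ≤ s := ht.1.trans hst'.1.le
      have h0' : 0 ≤ s' := ht'.1.trans (le_of_lt hst'')
      refine le_of_tendsto_of_tendsto (((hV (σ t)).tendsto _).comp (hx s' h0'))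
        (((hV (σ t)).tendsto _).comp (hx s h0)) ?_
      filter_upwards [hs, hs'] with k hk hk'
      have := (hp k).1.1.2 s (hdom k ▸ h0) s' (hdom k ▸ h0')
        (hst'.2.le.trans (le_of_lt hst'')) (hk.trans hk'.symm)
      rwa [hk, hk'] at this
    rw [← hst]
    exact ge_of_tendsto (((hV (σ t)).tendsto _).comp (hxr t ht.1)) key
  · intro t ht
    refine (hχ (σ t)).mem_of_tendsto (hxr t ht.1) ?_
    filter_upwards [hconv t ht.1, self_mem_nhdsWithin] with s hs hts
    have h0 : 0 ≤ s := ht.1.trans (le_of_lt hts)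
    refine (hχ (σ t)).mem_of_tendsto (hx s h0) ?_
    filter_upwards [hs] with k hk
    rw [← hk]
    exact (hp k).1.2.2 s (hdom k ▸ h0)

/-! ### Time shifts -/

/-- The trajectory restarted at time `s`. It is only used for trajectories defined on `[0, ∞)`. -/
def Traj.shift (p : Traj n m) (s : ℝ) : Traj n m :=
  ⟨fun t => p.x (t + s), fun t => p.σ (t + s), p.T⟩

theorem continuousAt_shift_iff {s t : ℝ} :
    ContinuousAt (fun u => σ (u + s)) t ↔ ContinuousAt σ (t + s) := by
  refine ⟨fun hc => ?_, fun hc => ContinuousAt.comp (f := fun u => u + s) hc (by fun_prop)⟩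
  have h1 : ContinuousAt (fun u : ℝ => u - s) (t + s) := by fun_prop
  have h2 := ContinuousAt.comp (f := fun u : ℝ => u - s) (x := t + s)
    (g := fun u => σ (u + s)) (by simpa using hc) h1
  simpa [Function.comp_def] using h2

theorem mem_discontinuities_shift {s t : ℝ} (hs : 0 ≤ s) :
    t ∈ discontinuities (fun u => σ (u + s)) ↔ 0 < t ∧ t + s ∈ discontinuities σ := by
  simp only [discontinuities, mem_ofPred_eq, continuousAt_shift_iff]
  exact ⟨fun h => ⟨h.1, by linarith [h.1], h.2⟩, fun h => ⟨h.1, h.2.2⟩⟩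

theorem IsSwitchingSignal.shift (hσ : IsSwitchingSignal σ) {s : ℝ} (hs : 0 ≤ s) :
    IsSwitchingSignal fun u => σ (u + s) where
  right_continuous t ht := by
    have h1 : ContinuousWithinAt σ (Ici (t + s)) (t + s) := hσ.right_continuous _ (by linarith)
    refine h1.comp (f := fun u => u + s) (by fun_prop) fun u hu => ?_
    exact add_le_add_left (mem_Ici.1 hu) s
  locally_finite b := by
    refine ((hσ.locally_finite (b + s)).preimage (add_left_injective s).injOn).subset fun t ht => ?_
    exact ⟨((mem_discontinuities_shift hs).1 ht.1).2, add_le_add_left ht.2 s⟩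

theorem HasAverageDwellTime.shift {τ : ℝ} {N : ℕ} (h : HasAverageDwellTime τ N σ)
    (hσ : IsSwitchingSignal σ) {s : ℝ} (hs : 0 ≤ s) :
    HasAverageDwellTime τ N fun u => σ (u + s) := by
  intro a b ha hab
  have h1 := h (a + s) (b + s) (by linarith) (by linarith)
  rw [add_sub_add_right_eq_sub] at h1
  refine le_trans (Nat.cast_le.2 ?_) h1
  refine Set.ncard_le_ncard_of_injOn (fun t => t + s) (fun t ht => ?_)
    (add_left_injective s).injOn
    ((hσ.locally_finite (b + s)).subset fun _ h => ⟨h.1, h.2.2.le⟩)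
  exact ⟨((mem_discontinuities_shift hs).1 ht.1).2, by linarith [ht.2.1], by linarith [ht.2.2]⟩

theorem Traj.dom_shift (s : ℝ) : (p.shift s).dom = p.dom := rfl

theorem Traj.IsMaximal.shift (hp : p.IsMaximal f) (hT : p.T = ⊤) {s : ℝ} (hs : 0 ≤ s) :
    (p.shift s).IsMaximal f := by
  refine isMaximal_of_T_eq_top hT (hp.isSwitchingSignal.shift hs) ?_
  have hx := hp.isSolution
  rw [Traj.dom_shift, Traj.dom_eq_Ici hT]
  have hdom := Traj.dom_eq_Ici hT
  refine ⟨?_, fun t ht hts => ?_⟩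
  · rw [hdom] at hx
    exact hx.continuousOn.comp (f := fun u => u + s) (by fun_prop) fun u hu =>
      add_nonneg (mem_Ici.1 hu) hs
  · have ht0 : 0 < t := (mem_Ici.1 ht).lt_of_ne fun h0 => hts (Or.inl h0.symm)
    have hts' : t + s ∉ switchingTimes p.σ := by
      rintro (h0 | h0)
      · exact (add_pos_of_pos_of_nonneg ht0 hs).ne' h0
      · exact hts (Or.inr ((mem_discontinuities_shift hs).2 ⟨ht0, h0⟩))
    have h1 := hasDerivAt_of_notMem_switchingTimes hx
      (t := t + s) (by rw [hdom]; exact add_nonneg (mem_Ici.1 ht) hs) hts'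
    exact (h1.comp_add_const t s).hasDerivWithinAt

theorem shift_mem_nonincreasingTrajs (hp : p ∈ nonincreasingTrajs f V) (hT : p.T = ⊤) {s : ℝ}
    (hs : 0 ≤ s) : p.shift s ∈ nonincreasingTrajs f V := by
  refine ⟨hp.1.shift hT hs, fun t ht t' ht' htt h => ?_⟩
  rw [Traj.dom_shift, Traj.dom_eq_Ici hT] at ht ht'
  exact hp.2 _ (by rw [Traj.dom_eq_Ici hT]; exact add_nonneg ht hs) _
    (by rw [Traj.dom_eq_Ici hT]; exact add_nonneg ht' hs) (add_le_add_left htt s) h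

theorem shift_mem_coveredTrajs (hp : p ∈ coveredTrajs f χ) (hT : p.T = ⊤) {s : ℝ}
    (hs : 0 ≤ s) : p.shift s ∈ coveredTrajs f χ := by
  refine ⟨hp.1.shift hT hs, fun t ht => ?_⟩
  rw [Traj.dom_shift, Traj.dom_eq_Ici hT] at ht
  exact hp.2 _ (by rw [Traj.dom_eq_Ici hT]; exact add_nonneg ht hs)

theorem shift_mem_dwellTrajs {τ : ℝ} {N : ℕ} (hp : p ∈ dwellTrajs f τ N) (hT : p.T = ⊤) {s : ℝ}
    (hs : 0 ≤ s) : p.shift s ∈ dwellTrajs f τ N :=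
  ⟨hp.1.shift hT hs, hp.2.shift hp.1.isSwitchingSignal hs⟩

theorem shift_mem_constantTrajs (hp : p ∈ constantTrajs f V) (hT : p.T = ⊤) {s : ℝ}
    (hs : 0 ≤ s) : p.shift s ∈ constantTrajs f V := by
  refine ⟨shift_mem_nonincreasingTrajs hp.1 hT hs, fun t ht t' ht' h => ?_⟩
  rw [Traj.dom_shift, Traj.dom_eq_Ici hT] at ht ht'
  exact hp.2 _ (by rw [Traj.dom_eq_Ici hT]; exact add_nonneg ht hs) _
    (by rw [Traj.dom_eq_Ici hT]; exact add_nonneg ht' hs) h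

/-! ### Convergence -/

/-- The orbit of a global trajectory is weakly invariant. -/
theorem isWeaklyInvariant_orbit {F : Set (Traj n m)} (hT : p.T = ⊤)
    (hF : ∀ s, 0 ≤ s → p.shift s ∈ F) :
    IsWeaklyInvariant F ((fun t => (p.x t, p.σ t)) '' Ici 0) := by
  refine ⟨⟨_, 0, self_mem_Ici, rfl⟩, ?_⟩
  rintro _ ⟨s, hs, rfl⟩
  refine ⟨p.shift s, hF s hs, by simp [Traj.shift], by simp [Traj.shift], fun t ht => ?_⟩
  rw [Traj.dom_shift, Traj.dom_eq_Ici hT] at ht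
  exact ⟨t + s, mem_Ici.2 (add_nonneg ht hs), rfl⟩

theorem HasKInftyBounds.exists_bound (h : HasKInftyBounds χ V) :
    ∃ α, IsClassKInfty α ∧ ∀ p ∈ nonincreasingTrajs f V ∩ coveredTrajs f χ, p.T = ⊤ →
      ∀ s t, 0 ≤ s → s ≤ t → ‖p.x t‖₊ ≤ α ‖p.x s‖₊ := by
  obtain ⟨α, hα, h⟩ := h.exists_stability_gain (f := f)
  refine ⟨α, hα, fun p hp hT s t hs hst => h p hp s ?_ t ?_ hst⟩
  · rw [Traj.dom_eq_Ici hT]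
    exact hs
  · rw [Traj.dom_eq_Ici hT]
    exact hs.trans hst

/-- Shifts of a trajectory by `s k → ∞` converge to a trajectory along which `V` is constant in
each mode. -/
theorem constant_of_tendsto_shift (hV : ∀ γ, Continuous fun ξ => V ξ γ)
    (hp : p ∈ nonincreasingTrajs f V) (hT : p.T = ⊤) {s : ℕ → ℝ} (hs0 : ∀ k, 0 ≤ s k)
    (hs : Tendsto s atTop atTop) {U : Ultrafilter ℕ} (hU : (U : Filter ℕ) ≤ atTop)
    {q : Traj n m} (hq : q ∈ nonincreasingTrajs f V) (hqT : q.T = ⊤)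
    (hx : ∀ t, 0 ≤ t → Tendsto (fun k => (p.shift (s k)).x t) U (𝓝 (q.x t)))
    (hσ : ∀ t, 0 ≤ t → ∀ᶠ u in 𝓝[>] t, ∀ᶠ k in (U : Filter ℕ), (p.shift (s k)).σ u = q.σ t) :
    q ∈ constantTrajs f V := by
  have hdom := Traj.dom_eq_Ici hT
  have hqdom := Traj.dom_eq_Ici hqT
  have hxr : ∀ t, 0 ≤ t → Tendsto q.x (𝓝[>] t) (𝓝 (q.x t)) := fun t ht => by
    have h1 := hq.1.isSolution.continuousOn
    rw [hqdom] at h1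
    exact (h1 t ht).mono (Ioi_subset_Ici_self.trans (Ici_subset_Ici.2 ht))
  -- No order between `t` and `t'` is required: for fixed `k`, all late `l` satisfy `u + s l ≥ u' +
  -- s k`, so monotonicity along `p` compares the two values. The limit is taken in `l` first, then
  -- in `k`.
  have key : ∀ t, 0 ≤ t → ∀ t', 0 ≤ t' → q.σ t = q.σ t' →
      V (q.x t) (q.σ t) ≤ V (q.x t') (q.σ t) := by
    intro t ht t' ht' h
    refine le_of_tendsto (((hV (q.σ t)).tendsto _).comp (hxr t ht)) ?_
    filter_upwards [hσ t ht, self_mem_nhdsWithin] with u hu htu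
    refine ge_of_tendsto (((hV (q.σ t)).tendsto _).comp (hxr t' ht')) ?_
    filter_upwards [hσ t' ht', self_mem_nhdsWithin] with u' hu' htu'
    have hu0 : 0 ≤ u := ht.trans (le_of_lt htu)
    have hu0' : 0 ≤ u' := ht'.trans (le_of_lt htu')
    refine ge_of_tendsto (((hV (q.σ t)).tendsto _).comp (hx u' hu0')) ?_
    filter_upwards [hu'] with k hk
    refine le_of_tendsto (((hV (q.σ t)).tendsto _).comp (hx u hu0)) ?_
    filter_upwards [hu, hU (hs.eventually_ge_atTop (u' + s k))] with l hl hle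
    have h1 := hp.2 (u' + s k) (by rw [hdom]; exact add_nonneg hu0' (hs0 k)) (u + s l)
      (by rw [hdom]; exact add_nonneg hu0 (hs0 l)) (hle.trans (le_add_of_nonneg_left hu0))
      (hk.trans (h.symm.trans hl.symm))
    rw [show p.σ (u + s l) = q.σ t from hl, show p.σ (u' + s k) = q.σ t from hk.trans h.symm] at h1
    exact h1
  refine ⟨hq, fun t ht t' ht' h => ?_⟩
  rw [hqdom] at ht ht'
  refine le_antisymm (h ▸ key t ht t' ht' h) ?_
  rw [h]
  exact key t' ht' t ht h.symm

/-- LaSalle's principle: if the weakly invariant sets of trajectories with constant `V` are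
contained in `{0} × Γ`, then trajectories with nonincreasing `V` converge to zero. -/
theorem tendsto_zero_of_weaklyInvariant (hf : ∀ γ, Continuous (f γ)) (hχ : ∀ γ, IsClosed (χ γ))
    (hV : ∀ γ, Continuous fun ξ => V ξ γ) (hb : HasKInftyBounds χ V)
    (hM : ∀ M, IsWeaklyInvariant (constantTrajs f V ∩ coveredTrajs f χ ∩ averageDwellTrajs f) M →
      ∀ q ∈ M, q.1 = 0)
    {τ : ℝ} {N : ℕ} (hτ : 0 < τ) (hN : 0 < N)
    (hp : p ∈ nonincreasingTrajs f V ∩ coveredTrajs f χ ∩ dwellTrajs f τ N) :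
    Tendsto p.x atTop (𝓝 0) := by
  have hT := T_eq_top_of_bounds hf hb hp.1
  obtain ⟨α, -, hα⟩ := hb.exists_bound (f := f)
  rw [Metric.tendsto_atTop]
  by_contra! hc
  obtain ⟨ε, hε, hc⟩ := hc
  choose s hs hsε using fun k : ℕ => hc k
  have hs0 : ∀ k, 0 ≤ s k := fun k => (Nat.cast_nonneg k).trans (hs k)
  have hlim : Tendsto s atTop atTop := tendsto_atTop_mono hs tendsto_natCast_atTop_atTop
  obtain ⟨q, hq, hqT, hx, hσ⟩ := exists_limit_trajectory (hyperfilter ℕ) hf hχ hV (τ := τ) (N := N)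
    (ps := fun k => p.shift (s k)) (R := α ‖p.x 0‖₊)
    (fun k => ⟨⟨shift_mem_nonincreasingTrajs hp.1.1 hT (hs0 k),
      shift_mem_coveredTrajs hp.1.2 hT (hs0 k)⟩, shift_mem_dwellTrajs hp.2 hT (hs0 k)⟩)
    (fun _ => hT) (fun k t ht => by
      exact_mod_cast hα p hp.1 hT 0 (t + s k) le_rfl (add_nonneg ht (hs0 k)))
  have hqc := constant_of_tendsto_shift hV hp.1.1 hT hs0 hlim Nat.hyperfilter_le_atTop hq.1.1 hqT
    hx hσ
  have hinv := isWeaklyInvariant_orbit hqT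
    (F := constantTrajs f V ∩ coveredTrajs f χ ∩ averageDwellTrajs f) fun u hu =>
      ⟨⟨shift_mem_constantTrajs hqc hqT hu, shift_mem_coveredTrajs hq.1.2 hqT hu⟩, τ, N, hτ, hN,
        shift_mem_dwellTrajs hq.2 hqT hu⟩
  have hq0 : q.x 0 = 0 := hM _ hinv _ ⟨0, self_mem_Ici, rfl⟩
  have h0 := (hx 0 le_rfl).dist (tendsto_const_nhds (x := (0 : EuclideanSpace ℝ (Fin n))))
  rw [hq0, dist_self] at h0
  refine hε.not_ge (ge_of_tendsto h0 (Eventually.of_forall fun k => ?_))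
  simpa [Traj.shift] using hsε k

/-- Attractivity is uniform among trajectories with the same average dwell-time and chatter
bound. -/
theorem exists_uniform_time (hf : ∀ γ, Continuous (f γ)) (hχ : ∀ γ, IsClosed (χ γ))
    (hV : ∀ γ, Continuous fun ξ => V ξ γ) (hb : HasKInftyBounds χ V)
    (hM : ∀ M, IsWeaklyInvariant (constantTrajs f V ∩ coveredTrajs f χ ∩ averageDwellTrajs f) M →
      ∀ q ∈ M, q.1 = 0)
    {τ : ℝ} {N : ℕ} (hτ : 0 < τ) (hN : 0 < N) (R : ℝ) {ε : ℝ} (hε : 0 < ε) :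
    ∃ k : ℕ, ∀ p ∈ nonincreasingTrajs f V ∩ coveredTrajs f χ ∩ dwellTrajs f τ N, ∀ s t,
      0 ≤ s → ‖p.x s‖ ≤ R → s + k ≤ t → ‖p.x t‖ ≤ ε := by
  obtain ⟨α, hα, hαb⟩ := hb.exists_bound (f := f)
  by_contra! hc
  choose p hp s t hs0 hsR hst hε' using hc
  have hT : ∀ k, (p k).T = ⊤ := fun k => T_eq_top_of_bounds hf hb (hp k).1
  -- With `α δ = ε`, a trajectory that once drops below `δ` stays within `ε` forever, so the
  -- counterexamples remain above `δ` for a time `k`.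
  obtain ⟨δ, hδ⟩ := hα.surjective ε.toNNReal
  have hδ0 : 0 < δ := by
    refine pos_iff_ne_zero.2 fun h0 => ?_
    rw [h0, hα.map_zero] at hδ
    exact (Real.toNNReal_pos.2 hε).ne hδ
  have hlow : ∀ (k : ℕ) (u : ℝ), 0 ≤ u → u ≤ k → (δ : ℝ) ≤ ‖((p k).shift (s k)).x u‖ := by
    intro k u hu huk
    by_contra! hlt
    have h1 := hαb (p k) (hp k).1 (hT k) (u + s k) (t k) (add_nonneg hu (hs0 k))
      (by linarith [hst k])
    have h2 : α ‖(p k).x (u + s k)‖₊ ≤ α δ := hα.strictMono.monotone (le_of_lt hlt)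
    rw [hδ] at h2
    have h3 : (‖(p k).x (t k)‖₊ : ℝ) ≤ ε.toNNReal := NNReal.coe_le_coe.2 (h1.trans h2)
    rw [Real.coe_toNNReal _ hε.le] at h3
    exact (hε' k).not_ge h3
  obtain ⟨q, hq, hqT, hx, -⟩ := exists_limit_trajectory (hyperfilter ℕ) hf hχ hV (τ := τ) (N := N)
    (ps := fun k => (p k).shift (s k)) (R := α R.toNNReal)
    (fun k => ⟨⟨shift_mem_nonincreasingTrajs (hp k).1.1 (hT k) (hs0 k),
      shift_mem_coveredTrajs (hp k).1.2 (hT k) (hs0 k)⟩,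
      shift_mem_dwellTrajs (hp k).2 (hT k) (hs0 k)⟩)
    hT (fun k u hu => by
      have h1 := hαb (p k) (hp k).1 (hT k) (s k) (u + s k) (hs0 k) (le_add_of_nonneg_left hu)
      have h2 : ‖(p k).x (s k)‖₊ ≤ R.toNNReal := by
        rw [← norm_toNNReal]
        exact Real.toNNReal_le_toNNReal (hsR k)
      exact_mod_cast h1.trans (hα.strictMono.monotone h2))
  have hq0 := (tendsto_zero_of_weaklyInvariant hf hχ hV hb hM hτ hN hq).norm
  rw [norm_zero] at hq0
  refine (NNReal.coe_pos.2 hδ0).not_ge (ge_of_tendsto hq0 ?_)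
  filter_upwards [eventually_ge_atTop 0] with u hu
  refine ge_of_tendsto (hx u hu).norm (Nat.hyperfilter_le_atTop ?_)
  filter_upwards [(tendsto_natCast_atTop_atTop (R := ℝ)).eventually_ge_atTop u] with k hk
  exact hlow k u hu hk

/-- Uniform stability and uniform attractivity together give an estimate of class `KL`. -/
theorem globallyUniformlyAsymptoticallyStable_of_attractive {F : Set (Traj n m)}
    {α : ℝ≥0 → ℝ≥0} (hα : IsClassKInfty α) (hT : ∀ p ∈ F, p.T = ⊤)
    (hst : ∀ p ∈ F, ∀ s t, 0 ≤ s → s ≤ t → ‖p.x t‖₊ ≤ α ‖p.x s‖₊)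
    (hat : ∀ R ε : ℝ, 0 < ε → ∃ k : ℕ, ∀ p ∈ F, ∀ s t, 0 ≤ s → ‖p.x s‖ ≤ R → s + k ≤ t →
      ‖p.x t‖ ≤ ε) :
    GloballyUniformlyAsymptoticallyStable F := by
  -- Inserting 0 keeps the supremum nonnegative when no trajectory qualifies; `s ≤ t` is listed
  -- separately because `d` may be negative.
  set S : ℝ → ℝ → Set ℝ := fun r d =>
    insert 0 {y | ∃ p ∈ F, ∃ s t, 0 ≤ s ∧ s ≤ t ∧ s + d ≤ t ∧ ‖p.x s‖ ≤ r ∧ y = ‖p.x t‖}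
  have hne : ∀ r d, (S r d).Nonempty := fun r d => ⟨0, mem_insert _ _⟩
  have hub : ∀ r d, ∀ y ∈ S r d, y ≤ α r.toNNReal := by
    rintro r d y (rfl | ⟨p, hp, s, t, hs, hst', -, hr, rfl⟩)
    · exact NNReal.coe_nonneg _
    · have h2 : ‖p.x s‖₊ ≤ r.toNNReal := by
        rw [← norm_toNNReal]
        exact Real.toNNReal_le_toNNReal hr
      exact_mod_cast (hst p hp s t hs hst').trans (hα.strictMono.monotone h2)
  have hbdd : ∀ r d, BddAbove (S r d) := fun r d => ⟨_, hub r d⟩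
  have h0 : ∀ r d, 0 ≤ sSup (S r d) := fun r d => le_csSup (hbdd r d) (mem_insert _ _)
  have hmono : ∀ d, Monotone fun r => sSup (S r d) := by
    intro d r r' hr
    refine csSup_le_csSup (hbdd _ _) (hne _ _) (insert_subset_insert ?_)
    rintro y ⟨p, hp, s, t, h1, h2, h3, h4, h5⟩
    exact ⟨p, hp, s, t, h1, h2, h3, h4.trans hr, h5⟩
  have hanti : ∀ r, Antitone fun d => sSup (S r d) := by
    intro r d d' hd
    refine csSup_le_csSup (hbdd _ _) (hne _ _) (insert_subset_insert ?_)
    rintro y ⟨p, hp, s, t, h1, h2, h3, h4, h5⟩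
    exact ⟨p, hp, s, t, h1, h2, by linarith, h4, h5⟩
  have hlim : ∀ r, Tendsto (fun d => sSup (S r d)) atTop (𝓝 0) := by
    intro r
    rw [Metric.tendsto_atTop]
    intro ε hε
    obtain ⟨k, hk⟩ := hat r (ε / 2) (half_pos hε)
    refine ⟨k, fun d hd => ?_⟩
    rw [Real.dist_0_eq_abs, abs_of_nonneg (h0 r d)]
    refine lt_of_le_of_lt (csSup_le (hne r d) ?_) (half_lt_self hε)
    rintro y (rfl | ⟨p, hp, s, t, hs, -, hd', hr, rfl⟩)
    · exact (half_pos hε).le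
    · exact hk p hp s t hs hr (by linarith)
  obtain ⟨β, hβ, hle⟩ := exists_classKL_ge hα h0 hmono hanti
    (fun r d => csSup_le (hne r d) (hub r d)) hlim
  refine ⟨β, hβ, fun p hp => ⟨hT p hp, fun s t hs hst' => ?_⟩⟩
  have h1 := hle ‖p.x s‖₊ (t - s).toNNReal
  rw [← NNReal.coe_le_coe]
  refine le_trans (le_csSup (hbdd _ _) (Or.inr ⟨p, hp, s, t, hs, hst', ?_, le_rfl, rfl⟩)) h1
  rw [Real.coe_toNNReal _ (sub_nonneg.2 hst')]
  linarith

end Switched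

/-! ### The main theorem -/

theorem theorem2 {n m : ℕ}
    (f : Fin m → EuclideanSpace ℝ (Fin n) → EuclideanSpace ℝ (Fin n))
    (hf : ∀ γ, Continuous (f γ))
    (χ : Fin m → Set (EuclideanSpace ℝ (Fin n)))
    (hχ : Switched.IsClosedCovering χ)
    (hf0 : ∀ γ ∈ Switched.zeroModes χ, f γ 0 = 0)
    (F : Set (Switched.Traj n m))
    (hFχ : F ⊆ Switched.coveredTrajs f χ)
    (hFa : F ⊆ Switched.averageDwellTrajs f)
    (V : EuclideanSpace ℝ (Fin n) → Fin m → ℝ)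
    (hV : Switched.IsWeakLyapunovLike f χ F V)
    (hM : Switched.IsMaximalWeaklyInvariant
      (Switched.constantTrajs f V ∩ Switched.coveredTrajs f χ ∩ Switched.averageDwellTrajs f)
      (({0} : Set (EuclideanSpace ℝ (Fin n))) ×ˢ Switched.zeroModes χ)) :
    Switched.GloballyAsymptoticallyStable F ∧
      ∀ (τ : ℝ) (N : ℕ), 0 < τ → 0 < N → F ⊆ Switched.dwellTrajs f τ N →
        Switched.GloballyUniformlyAsymptoticallyStable F := by
  have hVc : ∀ γ, Continuous fun ξ => V ξ γ := fun γ => (hV.contDiff γ).continuous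
  have hb : Switched.HasKInftyBounds χ V := hV.bounds
  have hFG : ∀ p ∈ F, p ∈ Switched.nonincreasingTrajs f V ∩ Switched.coveredTrajs f χ :=
    fun p hp => ⟨hV.subset_nonincreasingTrajs hFχ hp, hFχ hp⟩
  have hT : ∀ p ∈ F, p.T = ⊤ := fun p hp => Switched.T_eq_top_of_bounds hf hb (hFG p hp)
  have hM0 : ∀ M, Switched.IsWeaklyInvariant (Switched.constantTrajs f V ∩
      Switched.coveredTrajs f χ ∩ Switched.averageDwellTrajs f) M → ∀ q ∈ M, q.1 = 0 :=
    fun M h q hq => (hM.2 h hq).1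
  obtain ⟨α, hα, hαb⟩ := hb.exists_bound (f := f)
  refine ⟨⟨⟨α, hα, fun p hp => ⟨hT p hp, hαb p (hFG p hp) (hT p hp)⟩⟩, fun p hp => ⟨hT p hp, ?_⟩⟩,
    fun τ N hτ hN hFd => ?_⟩
  -- Convergence of a single trajectory only involves its own shifts, so its own constants suffice;
  -- common ones matter for uniformity.
  · obtain ⟨τ, N, hτ, hN, hpd⟩ := hFa hp
    exact Switched.tendsto_zero_of_weaklyInvariant hf hχ.isClosed hVc hb hM0 hτ hN
      ⟨hFG p hp, hpd⟩
  · refine Switched.globallyUniformlyAsymptoticallyStable_of_attractive hα hT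
      (fun p hp => hαb p (hFG p hp) (hT p hp)) fun R ε hε => ?_
    obtain ⟨k, hk⟩ := Switched.exists_uniform_time hf hχ.isClosed hVc hb hM0 hτ hN R hε
    exact ⟨k, fun p hp => hk p ⟨hFG p hp, hFd hp⟩⟩
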